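/- Let $k\ge 1$ be an integer, let $\alpha=(\alpha_1,\dots,\alpha_k)\in(0,1]^k$ with $|\alpha|=\sum_i\alpha_i=1$, and let $P=(p_{ij})_{i,j\in[k]}$ be a symmetric real matrix with all entries $p_{ij}\in(0,1)$; all of these are fixed, independent of $n$. For $n\in\mathbb N$ let $G(n,\alpha,P)$ be the random graph whose vertex set is a disjoint union $V_1\cup\dots\cup V_k$ of $n$ vertices in total with $|V_i|=\lfloor\alpha_i n\rfloor$ for $i\le k-1$, and in which any two distinct vertices $u\in V_i$, $v\in V_j$ are joined by an edge with probability $p_{ij}$, independently for all pairs. For $c\in\mathbb R^k$ and $I\subseteq[k]$ put \[ g(c,I)=\sum_{i\in I}c_i+\frac12\sum_{i,j\in I}c_ic_j\ln(1-p_{ij}), \] let \[ \mathcal A=\{c\in\mathbb R_{\ge0}^k : g(c,I)\ge 0\text{ for all }\varnothing\ne I\subseteq[k]\}, \] and write $|c|=\sum_i|c_i|$ for the 1-norm. Then the maximum \[ c^\star=\max\{|c| : c\in\mathrm{conv}(\mathcal A)\cap\{t\alpha : t\in\mathbb R_{\ge 0}\}\} \] exists and is positive, and the chromatic number of $G\sim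 G(n,\alpha,P)$ satisfies, with high probability as $n\to\infty$, \[ \chi(G)=(1+o(1))\,\frac{n}{c^\star\ln n}, \] that is, for every $\varepsilon>0$, \[ \Pr\Big[\,\Big|\chi(G)-\frac{n}{c^\star\ln n}\Big|\le\varepsilon\,\frac{n}{c^\star\ln n}\Big]\to 1\quad\text{as } n\to\infty . \] -/

import Mathlib

open MeasureTheory Filter Topology

noncomputable section

namespace RandomBlockGraph

/-- The 1-norm of a vector in `ℝ^k`. -/
def oneNorm {k : ℕ} (c : Fin k → ℝ) : ℝ := ∑ i, |c i|

/-- The number of vertices of the `i`-th part: `⌊α_i n⌋` for every part but the last one, and the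
last part takes the vertices that remain of the `n`. -/
def blockSize {k : ℕ} (α : Fin k → ℝ) (n : ℕ) (i : Fin k) : ℕ :=
  if (i : ℕ) + 1 = k then n - ∑ j ∈ Finset.univ.filter (fun j : Fin k => (j : ℕ) + 1 < k), ⌊α j * n⌋₊ else ⌊α i * n⌋₊

/-- The vertex set `V = V_1 ∪ ⋯ ∪ V_k`; the vertex `⟨i, x⟩` belongs to the part `V_i`. -/
abbrev Vertex {k : ℕ} (α : Fin k → ℝ) (n : ℕ) : Type :=
  (i : Fin k) × Fin (blockSize α n i)

/-- The probability `p_ij` of the edge `uv`, where `u ∈ V_i` and `v ∈ V_j`. -/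
def edgeProb {k : ℕ} (α : Fin k → ℝ) (P : Matrix (Fin k) (Fin k) ℝ) (hP : P.IsSymm) (n : ℕ) :
    Sym2 (Vertex α n) → ℝ :=
  Sym2.lift ⟨fun u v => P u.1 v.1, fun u v => hP.apply v.1 u.1⟩

/-- The law of the random block graph `G(n, α, P)`: independent Bernoulli variables, one for each
unordered pair of vertices, decide which pairs are edges. (The projection onto `[0, 1]` does not
change the entries of `P`, which lie there; `SimpleGraph.fromEdgeSet` ignores the pairs `uu`.) -/
def law {k : ℕ} (α : Fin k → ℝ) (P : Matrix (Fin k) (Fin k) ℝ) (hP : P.IsSymm) (n : ℕ) :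
    Measure (SimpleGraph (Vertex α n)) :=
  (Measure.pi fun e : Sym2 (Vertex α n) =>
      ProbabilityTheory.bernoulliMeasure true false
        (Set.projIcc (0 : ℝ) 1 zero_le_one (edgeProb α P hP n e))).map
    fun ω => SimpleGraph.fromEdgeSet {e | ω e = true}

/-- `g(c, I) = ∑_{i ∈ I} c_i + ½ ∑_{i, j ∈ I} c_i c_j ln (1 - p_ij)`. -/
def g {k : ℕ} (P : Matrix (Fin k) (Fin k) ℝ) (c : Fin k → ℝ) (I : Finset (Fin k)) : ℝ :=
  ∑ i ∈ I, c i + 1 / 2 * ∑ i ∈ I, ∑ j ∈ I, c i * c j * Real.log (1 - P i j)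

/-- The set `𝒜` of admissible types. -/
def admissible {k : ℕ} (P : Matrix (Fin k) (Fin k) ℝ) : Set (Fin k → ℝ) :=
  {c | (∀ i, 0 ≤ c i) ∧ ∀ I : Finset (Fin k), I.Nonempty → 0 ≤ g P c I}

/-- The 1-norms of the vectors in `conv(𝒜)` on the ray `{t α : t ≥ 0}`. -/
def rayNorms {k : ℕ} (α : Fin k → ℝ) (P : Matrix (Fin k) (Fin k) ℝ) : Set ℝ :=
  oneNorm '' (convexHull ℝ (admissible P) ∩ {c | ∃ t : ℝ, 0 ≤ t ∧ c = t • α})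

/-- The constant `c⋆`, as a supremum; that it is attained is part of the theorem. -/
def cStar {k : ℕ} (α : Fin k → ℝ) (P : Matrix (Fin k) (Fin k) ℝ) : ℝ := sSup (rayNorms α P)

/-- The chromatic number of a graph on finitely many vertices, as a real number. -/
def chi {V : Type} [Finite V] (G : SimpleGraph V) : ℝ := (G.chromaticNumber.toNat : ℝ)

end RandomBlockGraph

end

/-!
An admissible vector `c` is a possible shape of an independent set: one with `c i * log n` vertices
in each block `i`. By the first moment method, with high probability the independent sets of the
random graph have, up to `o(log n)`, only such shapes. Averaging the shapes of the `q` colour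
classes of a proper colouring then places `α * n / (q * log n)` essentially in the convex hull of
the admissible set, so `q` is at least about `n / (c⋆ * log n)`.

Conversely, write `c⋆ α` as a convex combination of admissible vectors. Fix one of them, shrunk
slightly, and split a large vertex set into disjoint cells, one for each vertex of the shape.
Janson's inequality, applied to the transversals of these cells, shows that they fail to contain an
independent set of that shape with a probability small enough for a union bound over all choices of
the vertex set. Hence independent sets of the shapes in the combination can be removed greedily, in
the right proportions, until `o(n / log n)` vertices are left, each of which receives its own
colour.
-/

namespace RandomBlockGraph

section ConvexHull

variable {E : Type*} [AddCommGroup E] [Module ℝ E] [FiniteDimensional ℝ E]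

theorem exists_sum_smul_eq_of_mem_convexHull {s : Set E} {x : E} (hx : x ∈ convexHull ℝ s) :
    ∃ w ∈ stdSimplex ℝ (Fin (Module.finrank ℝ E + 1)),
      ∃ z : Fin (Module.finrank ℝ E + 1) → E, (∀ i, z i ∈ s) ∧ ∑ i, w i • z i = x := by
  obtain ⟨a, ha⟩ := convexHull_nonempty_iff.1 ⟨x, hx⟩
  obtain ⟨ι, _, z, w, hz, hind, hw, hw1, rfl⟩ := eq_pos_convex_span_of_mem_convexHull hx
  have hcard : Fintype.card ι ≤ Fintype.card (Fin (Module.finrank ℝ E + 1)) := by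
    rw [Fintype.card_fin]
    exact hind.card_le_finrank_succ.trans (Nat.succ_le_succ (Submodule.finrank_le _))
  obtain ⟨e⟩ := Function.Embedding.nonempty_of_card_le hcard
  have hout : ∀ j, j ∉ Set.range e → Function.extend e w 0 j = 0 := fun j hj =>
    Function.extend_apply' _ _ _ hj
  refine ⟨Function.extend e w 0, ⟨fun j => ?_, ?_⟩, Function.extend e z fun _ => a, fun j => ?_, ?_⟩
  · by_cases hj : j ∈ Set.range e
    · obtain ⟨i, rfl⟩ := hj
      simpa only [e.injective.extend_apply] using (hw i).le
    · exact (hout j hj).ge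
  · rw [← hw1]
    exact (Finset.sum_of_injOn e e.injective.injOn (by simp)
      (fun j _ hj => hout j (by simpa using hj))
      fun i _ => (e.injective.extend_apply _ _ _).symm).symm
  · by_cases hj : j ∈ Set.range e
    · obtain ⟨i, rfl⟩ := hj
      simpa only [e.injective.extend_apply] using hz ⟨i, rfl⟩
    · simpa only [Function.extend_apply' _ _ _ hj] using ha
  · refine (Finset.sum_of_injOn e e.injective.injOn (by simp) (fun j _ hj => ?_) fun i _ => ?_).symm
    · simp only [hout j (by simpa using hj), zero_smul]
    · simp only [e.injective.extend_apply]

theorem isCompact_convexHull [TopologicalSpace E] [ContinuousAdd E] [ContinuousSMul ℝ E]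
    {s : Set E} (hs : IsCompact s) : IsCompact (convexHull ℝ s) := by
  let d := Module.finrank ℝ E + 1
  have himage : convexHull ℝ s = (fun p : (Fin d → ℝ) × (Fin d → E) => ∑ i, p.1 i • p.2 i) ''
      (stdSimplex ℝ (Fin d) ×ˢ Set.univ.pi fun _ => s) := by
    apply Set.Subset.antisymm
    · intro x hx
      obtain ⟨w, hw, z, hz, rfl⟩ := exists_sum_smul_eq_of_mem_convexHull hx
      exact ⟨(w, z), ⟨hw, fun i _ => hz i⟩, rfl⟩
    · rintro _ ⟨⟨w, z⟩, ⟨hw, hz⟩, rfl⟩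
      exact (convex_convexHull ℝ s).sum_mem (fun i _ => hw.1 i) hw.2
        fun i _ => subset_convexHull ℝ s (hz i trivial)
  rw [himage]
  exact ((isCompact_stdSimplex ℝ (Fin d)).prod (isCompact_univ_pi fun _ => hs)).image (by fun_prop)

end ConvexHull

section LogForm

variable {ι : Type*} [Fintype ι]

/-- The quadratic form `∑_{i,j} t_i t_j (-ln (1 - p_ij))`: a set with `t_i` vertices in the `i`-th
part is independent with probability about `exp (-quad P t / 2)`. -/
noncomputable def quad (P : Matrix ι ι ℝ) (t : ι → ℝ) : ℝ :=
  ∑ i, ∑ j, t i * t j * -Real.log (1 - P i j)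

/-- A positive upper bound for the numbers `-ln (1 - p_ij)`. -/
noncomputable def logBound (P : Matrix ι ι ℝ) : ℝ := 1 + ∑ i, ∑ j, |Real.log (1 - P i j)|

variable {P : Matrix ι ι ℝ}

theorem logBound_pos : 0 < logBound P := by
  unfold logBound
  positivity

theorem neg_log_le_logBound (i j : ι) : -Real.log (1 - P i j) ≤ logBound P :=
  calc -Real.log (1 - P i j) ≤ |Real.log (1 - P i j)| := neg_le_abs _
    _ ≤ ∑ j, |Real.log (1 - P i j)| := Finset.single_le_sum
        (f := fun j => |Real.log (1 - P i j)|) (fun _ _ => abs_nonneg _) (Finset.mem_univ j)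
    _ ≤ ∑ i, ∑ j, |Real.log (1 - P i j)| := Finset.single_le_sum
        (f := fun i => ∑ j, |Real.log (1 - P i j)|)
        (fun _ _ => Finset.sum_nonneg fun _ _ => abs_nonneg _) (Finset.mem_univ i)
    _ ≤ logBound P := le_add_of_nonneg_left zero_le_one

theorem quad_smul (a : ℝ) (t : ι → ℝ) : quad P (a • t) = a ^ 2 * quad P t := by
  simp only [quad, Finset.mul_sum, Pi.smul_apply, smul_eq_mul]
  exact Finset.sum_congr rfl fun i _ => Finset.sum_congr rfl fun j _ => by ring

theorem quad_le {t : ι → ℝ} (ht : ∀ i, 0 ≤ t i) : quad P t ≤ logBound P * (∑ i, t i) ^ 2 := by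
  rw [mul_comm, pow_two, Finset.sum_mul_sum]
  simp only [quad, Finset.sum_mul]
  exact Finset.sum_le_sum fun i _ => Finset.sum_le_sum fun j _ =>
    mul_le_mul_of_nonneg_left (neg_log_le_logBound i j) (mul_nonneg (ht i) (ht j))

end LogForm

section Admissible

variable {k : ℕ} {P : Matrix (Fin k) (Fin k) ℝ} {α c d : Fin k → ℝ} {I : Finset (Fin k)}

theorem g_univ : g P c Finset.univ = ∑ i, c i - 1 / 2 * quad P c := by
  simp [g, quad, Finset.sum_neg_distrib]

theorem g_congr (h : ∀ i ∈ I, c i = d i) : g P c I = g P d I := by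
  unfold g
  rw [Finset.sum_congr rfl h]
  congr 2
  refine Finset.sum_congr rfl fun i hi => Finset.sum_congr rfl fun j hj => ?_
  rw [h i hi, h j hj]

theorem g_indicator : g P (Set.indicator I c) Finset.univ = g P c I := by
  classical
  simp [g, Set.indicator_apply]

theorem g_insert {i : Fin k} (hi : i ∉ I) :
    g P c (insert i I) = c i + 1 / 2 * c i ^ 2 * Real.log (1 - P i i)
      + c i * (1 / 2 * ∑ j ∈ I, c j * (Real.log (1 - P i j) + Real.log (1 - P j i)))
      + g P c I := by
  unfold g
  simp only [Finset.sum_insert hi, Finset.sum_add_distrib, mul_add, Finset.mul_sum]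
  have hrow : ∀ j, 1 / 2 * (c i * c j * Real.log (1 - P i j))
      = c i * (1 / 2 * (c j * Real.log (1 - P i j))) := fun j => by ring
  have hcolumn : ∀ j, 1 / 2 * (c j * c i * Real.log (1 - P j i))
      = c i * (1 / 2 * (c j * Real.log (1 - P j i))) := fun j => by ring
  simp only [hrow, hcolumn]
  ring

theorem le_g (hc : ∀ i, 0 ≤ c i) (I : Finset (Fin k)) :
    ∑ i ∈ I, c i - 1 / 2 * (logBound P * (∑ i ∈ I, c i) ^ 2) ≤ g P c I := by
  have hq : quad P (Set.indicator I c) ≤ _ := quad_le (Set.indicator_nonneg fun i _ => hc i)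
  rw [Finset.sum_indicator_subset c (Finset.subset_univ I)] at hq
  rw [← g_indicator, g_univ, Finset.sum_indicator_subset c (Finset.subset_univ I)]
  linarith

theorem continuous_g (I : Finset (Fin k)) : Continuous fun c => g P c I := by
  unfold g
  fun_prop

theorem zero_mem_admissible : (0 : Fin k → ℝ) ∈ admissible P :=
  ⟨fun _ => le_rfl, fun I _ => by simp [g]⟩

theorem g_nonneg_of_mem_admissible (hc : c ∈ admissible P) (I : Finset (Fin k)) :
    0 ≤ g P c I := by
  rcases I.eq_empty_or_nonempty with rfl | hI
  · simp [g]
  · exact hc.2 I hI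

theorem quad_le_of_mem_admissible (hc : c ∈ admissible P) : quad P c ≤ 2 * ∑ i, c i := by
  have h := g_nonneg_of_mem_admissible hc Finset.univ
  rw [g_univ] at h
  linarith

/- Along the coordinate `i` the function `g` is a concave quadratic polynomial, so its values
between two nonnegative ones are nonnegative. -/
theorem update_mem_admissible (hPd : ∀ i, 0 ≤ P i i) (hP1 : ∀ i, P i i < 1)
    (hc : c ∈ admissible P) {i : Fin k} {t : ℝ} (ht0 : 0 ≤ t) (ht1 : t ≤ 1) :
    Function.update c i (t * c i) ∈ admissible P := by
  refine ⟨fun j => ?_, fun I _ => ?_⟩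
  · rcases eq_or_ne j i with rfl | h
    · simpa using mul_nonneg ht0 (hc.1 j)
    · simpa [h] using hc.1 j
  by_cases hi : i ∈ I
  · have hne : ∀ j ∈ I.erase i, Function.update c i (t * c i) j = c j := fun j hj =>
      Function.update_of_ne (Finset.ne_of_mem_erase hj) _ _
    have h1 := g_nonneg_of_mem_admissible hc I
    have h0 := g_nonneg_of_mem_admissible hc (I.erase i)
    rw [← Finset.insert_erase hi, g_insert (Finset.notMem_erase i I)] at h1 ⊢
    rw [g_congr hne, Finset.sum_congr rfl fun j hj => by rw [hne j hj], Function.update_self]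
    have hl : Real.log (1 - P i i) ≤ 0 :=
      Real.log_nonpos (sub_nonneg.2 (hP1 i).le) (sub_le_self _ (hPd i))
    have hcurv := mul_nonneg (mul_nonneg (mul_nonneg ht0 (sub_nonneg.2 ht1)) (sq_nonneg (c i)))
      (neg_nonneg.2 hl)
    nlinarith [mul_nonneg ht0 h1, mul_nonneg (sub_nonneg.2 ht1) h0]
  · rw [g_congr (d := c) fun j hj => Function.update_of_ne (ne_of_mem_of_not_mem hj hi) _ _]
    exact g_nonneg_of_mem_admissible hc I

theorem mul_mem_admissible (hPd : ∀ i, 0 ≤ P i i) (hP1 : ∀ i, P i i < 1)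
    (hc : c ∈ admissible P) {u : Fin k → ℝ} (hu0 : ∀ i, 0 ≤ u i) (hu1 : ∀ i, u i ≤ 1) :
    u * c ∈ admissible P := by
  classical
  have hpart : ∀ T : Finset (Fin k), T.piecewise (u * c) c ∈ admissible P := by
    intro T
    induction T using Finset.induction_on with
    | empty => simpa using hc
    | insert i T hi ih =>
      have h := update_mem_admissible hPd hP1 ih (i := i) (hu0 i) (hu1 i)
      rwa [Finset.piecewise_eq_of_notMem T (u * c) c hi, ← Pi.mul_apply u c i,
        ← Finset.piecewise_insert] at h
  simpa using hpart Finset.univ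

theorem exists_eq_mul_of_le {c d : Fin k → ℝ} (hd : ∀ i, 0 ≤ d i) (hdc : ∀ i, d i ≤ c i) :
    ∃ u : Fin k → ℝ, (∀ i, 0 ≤ u i) ∧ (∀ i, u i ≤ 1) ∧ u * c = d := by
  have hc : ∀ i, 0 ≤ c i := fun i => (hd i).trans (hdc i)
  refine ⟨d / c, fun i => div_nonneg (hd i) (hc i), fun i => div_le_one_of_le₀ (hdc i) (hc i), ?_⟩
  ext i
  rcases (hc i).eq_or_lt with h | h
  · simpa [← h] using ((hdc i).trans h.ge).antisymm (hd i) |>.symm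
  · exact div_mul_cancel₀ _ h.ne'

theorem mem_admissible_of_le (hPd : ∀ i, 0 ≤ P i i) (hP1 : ∀ i, P i i < 1)
    (hc : c ∈ admissible P) (hd : ∀ i, 0 ≤ d i) (hdc : ∀ i, d i ≤ c i) : d ∈ admissible P := by
  obtain ⟨u, hu0, hu1, rfl⟩ := exists_eq_mul_of_le hd hdc
  exact mul_mem_admissible hPd hP1 hc hu0 hu1

theorem mem_convexHull_admissible_of_le (hPd : ∀ i, 0 ≤ P i i) (hP1 : ∀ i, P i i < 1)
    (hc : c ∈ convexHull ℝ (admissible P)) (hd : ∀ i, 0 ≤ d i) (hdc : ∀ i, d i ≤ c i) :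
    d ∈ convexHull ℝ (admissible P) := by
  obtain ⟨u, hu0, hu1, rfl⟩ := exists_eq_mul_of_le hd hdc
  have h := Set.mem_image_of_mem (LinearMap.mulLeft ℝ u) hc
  rw [LinearMap.image_convexHull] at h
  refine convexHull_mono ?_ h
  rintro _ ⟨x, hx, rfl⟩
  exact mul_mem_admissible hPd hP1 hx hu0 hu1

theorem le_of_mem_admissible (hPd : ∀ i, 0 < P i i) (hP1 : ∀ i, P i i < 1)
    (hc : c ∈ admissible P) (i : Fin k) : c i ≤ 2 / -Real.log (1 - P i i) := by
  have h := hc.2 {i} (Finset.singleton_nonempty i)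
  have hl : Real.log (1 - P i i) < 0 :=
    Real.log_neg (sub_pos.2 (hP1 i)) (sub_lt_self _ (hPd i))
  simp only [g, Finset.sum_singleton] at h
  rw [le_div_iff₀ (neg_pos.2 hl)]
  rcases (hc.1 i).eq_or_lt with h0 | h0
  · simp [← h0]
  · by_contra! hlt
    nlinarith

theorem isCompact_admissible (hPd : ∀ i, 0 < P i i) (hP1 : ∀ i, P i i < 1) :
    IsCompact (admissible P) := by
  refine IsCompact.of_isClosed_subset
    (isCompact_univ_pi fun i => isCompact_Icc (a := 0) (b := 2 / -Real.log (1 - P i i))) ?_ ?_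
  · have hinter : admissible P = (⋂ i, {c | 0 ≤ c i}) ∩
        ⋂ I : Finset (Fin k), ⋂ _ : I.Nonempty, {c | 0 ≤ g P c I} := by
      ext c
      simp [admissible]
    rw [hinter]
    exact (isClosed_iInter fun i => isClosed_le continuous_const (continuous_apply i)).inter
      (isClosed_iInter fun I => isClosed_iInter fun _ =>
        isClosed_le continuous_const (continuous_g I))
  · exact fun c hc i _ => ⟨hc.1 i, le_of_mem_admissible hPd hP1 hc i⟩

theorem oneNorm_eq_sum (hα : ∀ i, 0 ≤ α i) : oneNorm α = ∑ i, α i :=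
  Finset.sum_congr rfl fun i _ => abs_of_nonneg (hα i)

theorem oneNorm_smul {t : ℝ} (ht : 0 ≤ t) (c : Fin k → ℝ) : oneNorm (t • c) = t * oneNorm c := by
  simp [oneNorm, abs_mul, abs_of_nonneg ht, Finset.mul_sum]

theorem rayNorms_eq (hα1 : oneNorm α = 1) :
    rayNorms α P = Set.Ici 0 ∩ (fun t : ℝ => t • α) ⁻¹' convexHull ℝ (admissible P) := by
  ext t
  constructor
  · rintro ⟨_, ⟨hc, s, hs, rfl⟩, rfl⟩
    rw [oneNorm_smul hs, hα1, mul_one]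
    exact ⟨hs, hc⟩
  · rintro ⟨h0, h⟩
    exact ⟨_, ⟨h, t, h0, rfl⟩, by rw [oneNorm_smul h0, hα1, mul_one]⟩

theorem isGreatest_cStar (hα1 : oneNorm α = 1) (hPd : ∀ i, 0 < P i i) (hP1 : ∀ i, P i i < 1) :
    IsGreatest (rayNorms α P) (cStar α P) := by
  have hne : (rayNorms α P).Nonempty := by
    rw [rayNorms_eq hα1]
    exact ⟨0, Set.mem_Ici.2 le_rfl, by simpa using subset_convexHull ℝ _ zero_mem_admissible⟩
  have hhull := isCompact_convexHull (isCompact_admissible hPd hP1)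
  have hcont : Continuous (oneNorm (k := k)) := by
    unfold oneNorm
    fun_prop
  have hclosed : IsClosed (rayNorms α P) := by
    rw [rayNorms_eq hα1]
    exact isClosed_Ici.inter (hhull.isClosed.preimage (by fun_prop))
  have hcompact : IsCompact (rayNorms α P) :=
    (hhull.image hcont).of_isClosed_subset hclosed (Set.image_mono Set.inter_subset_left)
  exact hcompact.isGreatest_sSup hne

theorem le_cStar (hα1 : oneNorm α = 1) (hPd : ∀ i, 0 < P i i) (hP1 : ∀ i, P i i < 1) {t : ℝ}
    (ht : 0 ≤ t) (h : t • α ∈ convexHull ℝ (admissible P)) : t ≤ cStar α P :=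
  (isGreatest_cStar hα1 hPd hP1).2 (by rw [rayNorms_eq hα1]; exact ⟨ht, h⟩)

theorem cStar_smul_mem_convexHull (hα1 : oneNorm α = 1) (hPd : ∀ i, 0 < P i i)
    (hP1 : ∀ i, P i i < 1) : cStar α P • α ∈ convexHull ℝ (admissible P) := by
  have h := (isGreatest_cStar hα1 hPd hP1).1
  rw [rayNorms_eq hα1] at h
  exact h.2

theorem inv_logBound_smul_mem_admissible (hα : ∀ i, 0 ≤ α i) (hα1 : ∑ i, α i = 1) :
    (logBound P)⁻¹ • α ∈ admissible P := by
  have hB := logBound_pos (P := P)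
  have hc : ∀ i, 0 ≤ ((logBound P)⁻¹ • α) i := fun i =>
    mul_nonneg (inv_nonneg.2 hB.le) (hα i)
  refine ⟨hc, fun I _ => le_trans ?_ (le_g hc I)⟩
  have hs0 : 0 ≤ ∑ i ∈ I, α i := Finset.sum_nonneg fun i _ => hα i
  have hs1 : ∑ i ∈ I, α i ≤ 1 := hα1 ▸
    Finset.sum_le_sum_of_subset_of_nonneg (Finset.subset_univ I) fun i _ _ => hα i
  simp only [Pi.smul_apply, smul_eq_mul, ← Finset.mul_sum]
  have e : (logBound P)⁻¹ * ∑ i ∈ I, α i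
      - 1 / 2 * (logBound P * ((logBound P)⁻¹ * ∑ i ∈ I, α i) ^ 2)
      = (logBound P)⁻¹ * (∑ i ∈ I, α i) * (1 - 1 / 2 * ∑ i ∈ I, α i) := by
    field_simp
  rw [e]
  exact mul_nonneg (mul_nonneg (inv_nonneg.2 hB.le) hs0) (by linarith)

theorem cStar_pos (hα : ∀ i, 0 ≤ α i) (hα1 : oneNorm α = 1) (hPd : ∀ i, 0 < P i i)
    (hP1 : ∀ i, P i i < 1) : 0 < cStar α P :=
  (inv_pos.2 logBound_pos).trans_le <| le_cStar hα1 hPd hP1 (inv_pos.2 logBound_pos).le <|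
    subset_convexHull ℝ _ <| inv_logBound_smul_mem_admissible hα (oneNorm_eq_sum hα ▸ hα1)

end Admissible

section ProductMeasure

variable {E : Type*} [Fintype E] {X : E → Type*} [∀ e, MeasurableSpace (X e)]
  (μ : ∀ e, Measure (X e))

theorem measureReal_pi_singleton_mul [∀ e, SigmaFinite (μ e)] [∀ e, LinearOrder (X e)]
    (a b : ∀ e, X e) :
    (Measure.pi μ).real {a} * (Measure.pi μ).real {b} =
      (Measure.pi μ).real {a ⊓ b} * (Measure.pi μ).real {a ⊔ b} := by
  simp only [measureReal_def, Measure.pi_singleton, ENNReal.toReal_prod, ← Finset.prod_mul_distrib]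
  refine Finset.prod_congr rfl fun e _ => ?_
  rcases le_total (a e) (b e) with h | h
  · simp [h]
  · simp [h, mul_comm]

variable [∀ e, IsProbabilityMeasure (μ e)] [∀ e, Finite (X e)] [∀ e, MeasurableSingletonClass (X e)]

theorem integral_mul_of_dependsOn {S T : Finset E} (hST : Disjoint S T) {f h : (∀ e, X e) → ℝ}
    (hf : DependsOn f S) (hh : DependsOn h T) :
    ∫ ω, f ω * h ω ∂Measure.pi μ = (∫ ω, f ω ∂Measure.pi μ) * ∫ ω, h ω ∂Measure.pi μ := by
  obtain ⟨f', rfl⟩ := dependsOn_iff_exists_comp.1 hf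
  obtain ⟨h', rfl⟩ := dependsOn_iff_exists_comp.1 hh
  have hindep : ProbabilityTheory.iIndepFun (fun e (ω : ∀ e, X e) => ω e) (Measure.pi μ) :=
    ProbabilityTheory.iIndepFun_pi (X := fun e => id) fun e => aemeasurable_id
  have hfun := (hindep.indepFun_finset S T hST fun e => measurable_pi_apply e).comp
    (φ := f') (ψ := h') (measurable_of_finite _) (measurable_of_finite _)
  exact hfun.integral_fun_mul_eq_mul_integral (measurable_of_finite _).aestronglyMeasurable
    (measurable_of_finite _).aestronglyMeasurable

/- The product measure restricted to a sublattice still satisfies the lattice condition of the FKG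
inequality. -/
theorem setIntegral_mul_setIntegral_le [∀ e, LinearOrder (X e)] {A : Set (∀ e, X e)}
    (hA : ∀ a ∈ A, ∀ b ∈ A, a ⊓ b ∈ A ∧ a ⊔ b ∈ A) {f h : (∀ e, X e) → ℝ} (hf0 : 0 ≤ f)
    (hh0 : 0 ≤ h) (hf : Monotone f) (hh : Monotone h) :
    (∫ ω in A, f ω ∂Measure.pi μ) * ∫ ω in A, h ω ∂Measure.pi μ ≤
      (Measure.pi μ).real A * ∫ ω in A, f ω * h ω ∂Measure.pi μ := by
  classical
  have := fun e => Fintype.ofFinite (X e)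
  let w : (∀ e, X e) → ℝ := A.indicator fun ω => (Measure.pi μ).real {ω}
  have hintegral : ∀ φ : (∀ e, X e) → ℝ, ∫ ω in A, φ ω ∂Measure.pi μ = ∑ ω, w ω * φ ω := fun φ => by
    rw [← integral_indicator A.toFinite.measurableSet, integral_fintype Integrable.of_finite]
    refine Finset.sum_congr rfl fun ω _ => ?_
    by_cases hω : ω ∈ A <;> simp [w, hω]
  have hone : (Measure.pi μ).real A = ∑ ω, w ω := by
    simpa using hintegral fun _ => 1
  rw [hintegral, hintegral, hintegral, hone]
  refine fkg f h w (fun ω => Set.indicator_nonneg (fun _ _ => measureReal_nonneg) ω)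
    hf0 hh0 hf hh fun a b => ?_
  by_cases hab : a ∈ A ∧ b ∈ A
  · obtain ⟨hinf, hsup⟩ := hA a hab.1 b hab.2
    simp only [w, Set.indicator_of_mem hab.1, Set.indicator_of_mem hab.2,
      Set.indicator_of_mem hinf, Set.indicator_of_mem hsup]
    exact (measureReal_pi_singleton_mul μ a b).le
  · have hzero : w a * w b = 0 := by
      rcases not_and_or.1 hab with h | h <;> simp [w, h]
    rw [hzero]
    exact mul_nonneg (Set.indicator_nonneg (fun _ _ => measureReal_nonneg) _)
      (Set.indicator_nonneg (fun _ _ => measureReal_nonneg) _)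

theorem setIntegral_mul_integral_le [∀ e, LinearOrder (X e)] {A : Set (∀ e, X e)}
    (hA : ∀ a ∈ A, ∀ b ∈ A, a ⊓ b ∈ A ∧ a ⊔ b ∈ A) {S T : Finset E} (hST : Disjoint S T)
    (hAS : DependsOn (· ∈ A) S) {f h : (∀ e, X e) → ℝ} (hf0 : 0 ≤ f) (hh0 : 0 ≤ h)
    (hf : Monotone f) (hh : Monotone h) (hhT : DependsOn h T) :
    (∫ ω in A, f ω ∂Measure.pi μ) * ∫ ω, h ω ∂Measure.pi μ ≤
      ∫ ω in A, f ω * h ω ∂Measure.pi μ := by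
  have hAm : MeasurableSet A := A.toFinite.measurableSet
  have hindicator : DependsOn (A.indicator (1 : (∀ e, X e) → ℝ)) S := fun a b hab => by
    have : a ∈ A ↔ b ∈ A := (hAS hab).to_iff
    by_cases ha : a ∈ A <;> simp [ha, ← this]
  have hindep : ∫ ω in A, h ω ∂Measure.pi μ =
      (Measure.pi μ).real A * ∫ ω, h ω ∂Measure.pi μ := by
    rw [← integral_indicator_one hAm, ← integral_mul_of_dependsOn μ hST hindicator hhT,
      ← integral_indicator hAm]
    exact integral_congr_ae (.of_forall fun ω => by by_cases hω : ω ∈ A <;> simp [hω])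
  have hfkg := setIntegral_mul_setIntegral_le μ hA hf0 hh0 hf hh
  rw [hindep] at hfkg
  rcases (measureReal_nonneg (μ := Measure.pi μ) (s := A)).eq_or_lt with h0 | h0
  · rw [setIntegral_measure_zero _ ((measureReal_eq_zero_iff).1 h0.symm), zero_mul]
    exact setIntegral_nonneg hAm fun ω _ => mul_nonneg (hf0 ω) (hh0 ω)
  · exact le_of_mul_le_mul_left (by linarith) h0

end ProductMeasure

section FalseBits

variable {E ι : Type*}

/-- The event that all the bits in `F` are `false`. -/
def allFalse (F : Finset E) : Set (E → Bool) := {ω | ∀ e ∈ F, ω e = false}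

/-- The number of indices `i ∈ T` for which all the bits in `F i` are `false`. -/
noncomputable def falseCount (F : ι → Finset E) (T : Finset ι) (ω : E → Bool) : ℝ :=
  ∑ i ∈ T, (allFalse (F i)).indicator 1 ω

theorem mem_allFalse {F : Finset E} {ω : E → Bool} : ω ∈ allFalse F ↔ ∀ e ∈ F, ω e = false :=
  Iff.rfl

theorem allFalse_union [DecidableEq E] (F F' : Finset E) :
    allFalse (F ∪ F') = allFalse F ∩ allFalse F' := by
  ext ω
  simp only [mem_allFalse, Finset.mem_union, or_imp, forall_and, Set.mem_inter_iff]

theorem isLowerSet_allFalse (F : Finset E) : IsLowerSet (allFalse F) := fun _ _ hle h e he =>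
  Bool.eq_false_of_le_false ((hle e).trans (h e he).le)

theorem inf_sup_mem_allFalse (F : Finset E) :
    ∀ a ∈ allFalse F, ∀ b ∈ allFalse F, a ⊓ b ∈ allFalse F ∧ a ⊔ b ∈ allFalse F :=
  fun _ ha _ hb => ⟨isLowerSet_allFalse F inf_le_left ha, fun e he => by simp [ha e he, hb e he]⟩

theorem dependsOn_mem_allFalse (F : Finset E) : DependsOn (· ∈ allFalse F) (F : Set E) :=
  fun _ _ hab => propext (forall₂_congr fun e he => by rw [hab e he])

theorem falseCount_nonneg (F : ι → Finset E) (T : Finset ι) (ω : E → Bool) :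
    0 ≤ falseCount F T ω :=
  Finset.sum_nonneg fun _ _ => Set.indicator_nonneg (fun _ _ => zero_le_one) _

theorem antitone_falseCount (F : ι → Finset E) (T : Finset ι) : Antitone (falseCount F T) :=
  fun a b hab => Finset.sum_le_sum fun i _ => by
    by_cases hb : b ∈ allFalse (F i)
    · simp [hb, isLowerSet_allFalse (F i) hab hb]
    · rw [Set.indicator_of_notMem hb]
      exact Set.indicator_nonneg (fun _ _ => zero_le_one) a

theorem dependsOn_falseCount [DecidableEq E] (F : ι → Finset E) (T : Finset ι) :
    DependsOn (falseCount F T) (T.biUnion F : Set E) := fun a b hab =>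
  Finset.sum_congr rfl fun i hi => by
    have h : a ∈ allFalse (F i) ↔ b ∈ allFalse (F i) := (dependsOn_mem_allFalse (F i) fun e he =>
      hab e (Finset.mem_coe.2 (Finset.mem_biUnion.2 ⟨i, hi, he⟩))).to_iff
    by_cases ha : a ∈ allFalse (F i) <;> simp [ha, ← h]

theorem monotone_exp_mul_falseCount (F : ι → Finset E) (T : Finset ι) {t : ℝ} (ht : t ≤ 0) :
    Monotone fun ω => Real.exp (t * falseCount F T ω) := fun _ _ hab =>
  Real.exp_le_exp.2 (mul_le_mul_of_nonpos_left (antitone_falseCount F T hab) ht)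

end FalseBits

section Janson

open ProbabilityTheory

variable {E ι : Type*} [Fintype E]

/-- The law of independent bits indexed by `E`, the bit `e` being `true` with probability `p e`. -/
noncomputable def bitMeasure (p : E → unitInterval) : Measure (E → Bool) :=
  Measure.pi fun e => bernoulliMeasure true false (p e)

instance (p : E → unitInterval) : IsProbabilityMeasure (bitMeasure p) := by
  unfold bitMeasure
  infer_instance

variable (p : E → unitInterval)

theorem measureReal_allFalse (F : Finset E) :
    (bitMeasure p).real (allFalse F) = ∏ e ∈ F, (1 - p e : ℝ) := by
  have hpi : allFalse F = (F : Set E).pi fun _ => {false} := by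
    ext ω
    simp [mem_allFalse, Set.mem_pi]
  rw [hpi, measureReal_def, bitMeasure, Measure.pi_pi_finset, ENNReal.toReal_prod]
  refine Finset.prod_congr rfl fun e _ => ?_
  rw [← measureReal_def]
  simp

variable [DecidableEq E]

theorem le_setIntegral_exp_mul_falseCount (F : ι → Finset E) (F₀ : Finset E) (T : Finset ι)
    (t : ℝ) :
    ∏ e ∈ F₀, (1 - p e : ℝ) + t * ∑ j ∈ T, ∏ e ∈ F₀ ∪ F j, (1 - p e : ℝ) ≤
      ∫ ω in allFalse F₀, Real.exp (t * falseCount F T ω) ∂bitMeasure p := by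
  have hcount : ∫ ω in allFalse F₀, falseCount F T ω ∂bitMeasure p =
      ∑ j ∈ T, ∏ e ∈ F₀ ∪ F j, (1 - p e : ℝ) := by
    unfold falseCount
    rw [integral_finsetSum _ fun j _ => Integrable.of_finite]
    refine Finset.sum_congr rfl fun j _ => ?_
    rw [integral_indicator_one (Set.toFinite _).measurableSet,
      measureReal_restrict_apply (Set.toFinite _).measurableSet, ← measureReal_allFalse,
      allFalse_union, Set.inter_comm]
  calc _ = ∫ ω in allFalse F₀, (1 + t * falseCount F T ω) ∂bitMeasure p := by
        rw [integral_add Integrable.of_finite Integrable.of_finite, integral_const_mul, hcount,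
          setIntegral_const, measureReal_allFalse, smul_eq_mul, mul_one]
    _ ≤ _ := integral_mono Integrable.of_finite Integrable.of_finite fun ω => by
        simpa only [add_comm] using Real.add_one_le_exp (t * falseCount F T ω)

/- The sets `F j` disjoint from `F i` contribute a factor that is independent of the bits in `F i`;
the FKG inequality separates it from the factor of the remaining ones. -/
theorem mul_mgf_falseCount_le [Fintype ι] (F : ι → Finset E) {t : ℝ} (ht : t ≤ 0) (i : ι) :
    (∏ e ∈ F i, (1 - p e : ℝ) + t * ∑ j with ¬Disjoint (F i) (F j), ∏ e ∈ F i ∪ F j, (1 - p e : ℝ))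
      * mgf (falseCount F Finset.univ) (bitMeasure p) t ≤
    ∫ ω in allFalse (F i), Real.exp (t * falseCount F Finset.univ ω) ∂bitMeasure p := by
  let T := Finset.univ.filter fun j => ¬Disjoint (F i) (F j)
  let T' := Finset.univ.filter fun j => ¬¬Disjoint (F i) (F j)
  have hexp : ∀ ω, Real.exp (t * falseCount F Finset.univ ω) =
      Real.exp (t * falseCount F T ω) * Real.exp (t * falseCount F T' ω) := fun ω => by
    rw [← Real.exp_add, ← mul_add, falseCount, falseCount, falseCount,
      Finset.sum_filter_add_sum_filter_not]
  have hT' : Disjoint (F i) (T'.biUnion F) := (Finset.disjoint_biUnion_right _ _ _).2 fun j hj =>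
    not_not.1 (Finset.mem_filter.1 hj).2
  have hmgf : mgf (falseCount F Finset.univ) (bitMeasure p) t ≤
      ∫ ω, Real.exp (t * falseCount F T' ω) ∂bitMeasure p := by
    refine integral_mono Integrable.of_finite Integrable.of_finite fun ω => ?_
    simp only [hexp]
    exact mul_le_of_le_one_left (Real.exp_pos _).le
      (Real.exp_le_one_iff.2 (mul_nonpos_of_nonpos_of_nonneg ht (falseCount_nonneg _ _ _)))
  have hfkg := setIntegral_mul_integral_le (fun e => bernoulliMeasure true false (p e))
    (inf_sup_mem_allFalse (F i)) hT' (dependsOn_mem_allFalse (F i))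
    (fun ω => (Real.exp_pos _).le) (fun ω => (Real.exp_pos _).le)
    (monotone_exp_mul_falseCount F T ht) (monotone_exp_mul_falseCount F T' ht)
    fun a b hab => by rw [dependsOn_falseCount F T' hab]
  simp only [hexp]
  calc _ ≤ (∫ ω in allFalse (F i), Real.exp (t * falseCount F T ω) ∂bitMeasure p) *
          mgf (falseCount F Finset.univ) (bitMeasure p) t :=
        mul_le_mul_of_nonneg_right (le_setIntegral_exp_mul_falseCount p F (F i) T t) mgf_nonneg
    _ ≤ _ := mul_le_mul_of_nonneg_left hmgf (integral_nonneg fun ω => (Real.exp_pos _).le)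
    _ ≤ _ := hfkg

theorem le_mul_exp_of_mul_le_deriv {ψ ψ' : ℝ → ℝ} {m Δ : ℝ}
    (hψ : ∀ t, HasDerivAt ψ (ψ' t) t) (h : ∀ t ≤ 0, (m + t * Δ) * ψ t ≤ ψ' t) {t : ℝ}
    (ht : t ≤ 0) : ψ t ≤ ψ 0 * Real.exp (m * t + t ^ 2 * Δ / 2) := by
  let H : ℝ → ℝ := fun s => ψ s * Real.exp (-(m * s + s ^ 2 * Δ / 2))
  have hH : ∀ s, HasDerivAt H
      (Real.exp (-(m * s + s ^ 2 * Δ / 2)) * (ψ' s - (m + s * Δ) * ψ s)) s := fun s => by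
    have hq : HasDerivAt (fun s : ℝ => -(m * s + s ^ 2 * Δ / 2))
        (-(m * 1 + ((2 : ℕ) * s ^ (2 - 1) * 1) * Δ / 2)) s :=
      (((hasDerivAt_id s).const_mul m).add
        ((((hasDerivAt_id s).pow 2).mul_const Δ).div_const 2)).neg
    exact ((hψ s).mul hq.exp).congr_deriv (by push_cast; ring)
  have hmono : MonotoneOn H (Set.Iic 0) := by
    refine monotoneOn_of_deriv_nonneg (convex_Iic 0)
      (fun s _ => (hH s).continuousAt.continuousWithinAt)
      (fun s _ => (hH s).differentiableAt.differentiableWithinAt) fun s hs => ?_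
    rw [interior_Iic] at hs
    rw [(hH s).deriv]
    exact mul_nonneg (Real.exp_pos _).le (sub_nonneg.2 (h s (Set.mem_Iio.1 hs).le))
  have hle : H t ≤ H 0 := hmono ht Set.self_mem_Iic ht
  have h0 : H 0 = ψ 0 := by simp [H]
  rw [h0] at hle
  rwa [← div_le_iff₀ (Real.exp_pos _), div_eq_mul_inv, ← Real.exp_neg]

theorem janson_inequality [Fintype ι] (F : ι → Finset E) {Δ : ℝ} (hΔ0 : 0 < Δ)
    (hΔ : ∑ i, ∑ j with ¬Disjoint (F i) (F j), ∏ e ∈ F i ∪ F j, (1 - p e : ℝ) ≤ Δ) :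
    (bitMeasure p).real {ω | ∀ i, ω ∉ allFalse (F i)} ≤
      Real.exp (-((∑ i, ∏ e ∈ F i, (1 - p e : ℝ)) ^ 2 / (2 * Δ))) := by
  set m := ∑ i, ∏ e ∈ F i, (1 - p e : ℝ)
  let X := falseCount F Finset.univ
  have hm0 : 0 ≤ m := Finset.sum_nonneg fun i _ => Finset.prod_nonneg fun e _ =>
    sub_nonneg.2 (p e).2.2
  have hderiv : ∀ t, HasDerivAt (mgf X (bitMeasure p))
      (∫ ω, X ω * Real.exp (t * X ω) ∂bitMeasure p) t := fun t =>
    hasDerivAt_mgf (by simp [integrableExpSet, Integrable.of_finite])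
  have hgrowth : ∀ t ≤ 0, (m + t * Δ) * mgf X (bitMeasure p) t ≤
      ∫ ω, X ω * Real.exp (t * X ω) ∂bitMeasure p := fun t ht => by
    have hsum := Finset.sum_le_sum fun i (_ : i ∈ Finset.univ) => mul_mgf_falseCount_le p F ht i
    rw [← Finset.sum_mul, Finset.sum_add_distrib, ← Finset.mul_sum] at hsum
    refine (mul_le_mul_of_nonneg_right ?_ mgf_nonneg).trans (hsum.trans_eq ?_)
    · exact add_le_add_right (mul_le_mul_of_nonpos_left hΔ ht) m
    · simp only [X, falseCount, Finset.sum_mul]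
      rw [integral_finsetSum _ fun i _ => Integrable.of_finite]
      refine Finset.sum_congr rfl fun i _ => ?_
      rw [← integral_indicator (Set.toFinite _).measurableSet]
      refine integral_congr_ae (.of_forall fun ω => ?_)
      by_cases hω : ω ∈ allFalse (F i) <;> simp [hω]
  have ht : -(m / Δ) ≤ 0 := neg_nonpos.2 (by positivity)
  calc (bitMeasure p).real {ω | ∀ i, ω ∉ allFalse (F i)}
      ≤ (bitMeasure p).real {ω | X ω ≤ 0} := measureReal_mono fun ω hω =>
        show falseCount F Finset.univ ω ≤ 0 from
          Finset.sum_nonpos fun i _ => (Set.indicator_of_notMem (hω i) _).le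
    _ ≤ mgf X (bitMeasure p) (-(m / Δ)) := by
        simpa using measure_le_le_exp_mul_mgf (X := X) (μ := bitMeasure p) 0 ht
          Integrable.of_finite
    _ ≤ mgf X (bitMeasure p) 0 * Real.exp (m * -(m / Δ) + (-(m / Δ)) ^ 2 * Δ / 2) :=
        le_mul_exp_of_mul_le_deriv hderiv hgrowth ht
    _ = _ := by
        rw [mgf_zero, one_mul]
        congr 1
        field_simp
        ring

end Janson

section Pairs

variable {X : Type*} [DecidableEq X]

/-- The unordered pairs of distinct elements of `S`. -/
def pairs (S : Finset X) : Finset (Sym2 X) := S.sym2.filter fun e => ¬e.IsDiag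

theorem mk_mem_pairs {S : Finset X} {u v : X} : s(u, v) ∈ pairs S ↔ u ∈ S ∧ v ∈ S ∧ u ≠ v := by
  simp [pairs, and_assoc]

theorem sum_offDiag_eq_two_mul_sum_pairs (S : Finset X) (f : Sym2 X → ℝ) :
    ∑ x ∈ S.offDiag, f s(x.1, x.2) = 2 * ∑ e ∈ pairs S, f e := by
  have hmaps : ∀ x ∈ S.offDiag, s(x.1, x.2) ∈ pairs S := fun x hx => by
    simpa [mk_mem_pairs] using hx
  rw [← Finset.sum_fiberwise_of_maps_to hmaps, Finset.mul_sum]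
  refine Finset.sum_congr rfl fun e he => ?_
  induction e with
  | _ a b =>
    rw [mk_mem_pairs] at he
    have hfiber : S.offDiag.filter (fun x => s(x.1, x.2) = s(a, b)) = {(a, b), (b, a)} := by
      ext ⟨x, y⟩
      simp only [Finset.mem_filter, Finset.mem_offDiag, Sym2.eq_iff, Finset.mem_insert,
        Finset.mem_singleton, Prod.mk.injEq]
      grind
    rw [hfiber, Finset.sum_pair (by simp [he.2.2]), Sym2.eq_swap (a := b)]
    ring

theorem sum_pairs (S : Finset X) (f : Sym2 X → ℝ) :
    ∑ e ∈ pairs S, f e = 1 / 2 * ∑ u ∈ S, ∑ v ∈ S, f s(u, v) - 1 / 2 * ∑ u ∈ S, f s(u, u) := by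
  have hsplit : ∑ u ∈ S, ∑ v ∈ S, f s(u, v) =
      ∑ u ∈ S, f s(u, u) + ∑ x ∈ S.offDiag, f s(x.1, x.2) := by
    rw [← Finset.sum_product', ← Finset.diag_union_offDiag,
      Finset.sum_union (Finset.disjoint_diag_offDiag S), Finset.sum_diag]
  rw [hsplit, sum_offDiag_eq_two_mul_sum_pairs]
  ring

end Pairs

section RandomGraph

variable {V : Type*}

theorem measurableSet_of_finite [Finite V] (Q : Set (SimpleGraph V)) : MeasurableSet Q :=
  SimpleGraph.measurableEmbedding_edgeSet.measurableSet_image.1 (Set.toFinite _).measurableSet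

/-- The graph whose edges are the pairs with a `true` bit. -/
def graphOf (ω : Sym2 V → Bool) : SimpleGraph V := SimpleGraph.fromEdgeSet {e | ω e = true}

theorem graphOf_isIndepSet_iff [DecidableEq V] {ω : Sym2 V → Bool} {S : Finset V} :
    (graphOf ω).IsIndepSet (S : Set V) ↔ ω ∈ allFalse (pairs S) := by
  rw [mem_allFalse]
  constructor
  · intro h e he
    induction e with
    | _ u v =>
      rw [mk_mem_pairs] at he
      simpa [graphOf, he.2.2] using h he.1 he.2.1 he.2.2
  · intro h u hu v hv huv
    simp [graphOf, h _ (mk_mem_pairs.2 ⟨hu, hv, huv⟩)]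

variable [Fintype V]

/-- The random graph in which the pair `e` is an edge with probability `p e`, independently of the
other pairs; the diagonal pairs are ignored. -/
noncomputable def randomGraph (p : Sym2 V → unitInterval) : Measure (SimpleGraph V) :=
  (bitMeasure p).map graphOf

instance (p : Sym2 V → unitInterval) : IsProbabilityMeasure (randomGraph p) :=
  Measure.isProbabilityMeasure_map (measurable_of_finite _).aemeasurable

variable (p : Sym2 V → unitInterval)

theorem measureReal_randomGraph (Q : Set (SimpleGraph V)) :
    (randomGraph p).real Q = (bitMeasure p).real (graphOf ⁻¹' Q) :=
  map_measureReal_apply (measurable_of_finite _) (measurableSet_of_finite Q)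

variable [DecidableEq V]

theorem measureReal_isIndepSet (S : Finset V) :
    (randomGraph p).real {G | G.IsIndepSet (S : Set V)} = ∏ e ∈ pairs S, (1 - p e : ℝ) := by
  rw [measureReal_randomGraph, ← measureReal_allFalse]
  congr 1
  ext ω
  exact graphOf_isIndepSet_iff

theorem measureReal_forall_not_isIndepSet_le {κ : Type*} [Fintype κ] (S : κ → Finset V) {Δ : ℝ}
    (hΔ0 : 0 < Δ)
    (hΔ : ∑ i, ∑ j with ¬Disjoint (pairs (S i)) (pairs (S j)),
      ∏ e ∈ pairs (S i) ∪ pairs (S j), (1 - p e : ℝ) ≤ Δ) :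
    (randomGraph p).real {G | ∀ i, ¬G.IsIndepSet (S i : Set V)} ≤
      Real.exp (-((∑ i, ∏ e ∈ pairs (S i), (1 - p e : ℝ)) ^ 2 / (2 * Δ))) := by
  rw [measureReal_randomGraph]
  simpa only [Set.preimage_ofPred_eq, graphOf_isIndepSet_iff] using
    janson_inequality p (fun i => pairs (S i)) hΔ0 hΔ

end RandomGraph

section BlockCount

variable {ι V : Type*} [DecidableEq ι]

/-- The number of elements of `S` in the `i`-th block, where `τ` tells the block of an element. -/
def blockCount (τ : V → ι) (S : Finset V) (i : ι) : ℕ := (S.filter fun u => τ u = i).card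

variable [Fintype ι]

theorem sum_comp_block (τ : V → ι) (S : Finset V) (f : ι → ℝ) :
    ∑ u ∈ S, f (τ u) = ∑ i, blockCount τ S i * f i := by
  rw [← Finset.sum_fiberwise S τ]
  refine Finset.sum_congr rfl fun i _ => ?_
  rw [Finset.sum_congr rfl fun u hu => by rw [(Finset.mem_filter.1 hu).2], Finset.sum_const,
    nsmul_eq_mul, blockCount]

theorem sum_blockCount (τ : V → ι) (S : Finset V) : ∑ i, (blockCount τ S i : ℝ) = S.card := by
  simpa using (sum_comp_block τ S fun _ => 1).symm

theorem blockCount_sigma_univ (s : ι → ℕ) (i : ι) :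
    blockCount (Sigma.fst : ((i : ι) × Fin (s i)) → ι) Finset.univ i = s i := by
  rw [blockCount, ← Fintype.card_subtype, Fintype.card_congr (Equiv.sigmaSubtype i),
    Fintype.card_fin]

end BlockCount

section BlockGraph

variable {ι V : Type*} {P : Matrix ι ι ℝ}

/-- The edge probability `p_ij` of a pair `uv` whose elements are put into the blocks `i` and `j`
by `τ`. -/
def blockProb (hP : P.IsSymm) (τ : V → ι) : Sym2 V → ℝ :=
  Sym2.lift ⟨fun u v => P (τ u) (τ v), fun u v => hP.apply (τ v) (τ u)⟩

theorem blockProb_mk (hP : P.IsSymm) (τ : V → ι) (u v : V) :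
    blockProb hP τ s(u, v) = P (τ u) (τ v) := rfl

theorem blockProb_mem (hP : P.IsSymm) {I : Set ℝ} (hPI : ∀ i j, P i j ∈ I) (τ : V → ι)
    (e : Sym2 V) : blockProb hP τ e ∈ I := by
  induction e with
  | _ u v => exact hPI _ _

theorem coe_projIcc_blockProb (hP : P.IsSymm) (hP01 : ∀ i j, P i j ∈ Set.Icc (0 : ℝ) 1)
    (τ : V → ι) (e : Sym2 V) :
    (Set.projIcc (0 : ℝ) 1 zero_le_one (blockProb hP τ e) : ℝ) = blockProb hP τ e := by
  rw [Set.projIcc_of_mem zero_le_one (blockProb_mem hP hP01 τ e)]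

section

variable [Fintype ι] [DecidableEq ι] [DecidableEq V]

theorem prod_pairs_eq_exp (hP : P.IsSymm) (hP1 : ∀ i j, P i j < 1) (τ : V → ι) (S : Finset V) :
    ∏ e ∈ pairs S, (1 - blockProb hP τ e) =
      Real.exp (-(1 / 2 * quad P (fun i => blockCount τ S i))
        + 1 / 2 * ∑ u ∈ S, -Real.log (1 - P (τ u) (τ u))) := by
  have hexp : ∏ e ∈ pairs S, (1 - blockProb hP τ e) =
      Real.exp (∑ e ∈ pairs S, Real.log (1 - blockProb hP τ e)) := by
    rw [Real.exp_sum]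
    exact Finset.prod_congr rfl fun e _ => (Real.exp_log (sub_pos.2
      (blockProb_mem hP (I := Set.Iio 1) hP1 τ e))).symm
  have hquad : ∑ u ∈ S, ∑ v ∈ S, Real.log (1 - P (τ u) (τ v)) =
      -quad P (fun i => blockCount τ S i) := by
    rw [sum_comp_block τ S fun i => ∑ v ∈ S, Real.log (1 - P i (τ v)), quad,
      ← Finset.sum_neg_distrib]
    refine Finset.sum_congr rfl fun i _ => ?_
    rw [sum_comp_block τ S fun j => Real.log (1 - P i j), Finset.mul_sum,
      ← Finset.sum_neg_distrib]
    exact Finset.sum_congr rfl fun j _ => by ring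
  rw [hexp, sum_pairs]
  simp only [blockProb_mk]
  rw [hquad, Finset.sum_neg_distrib]
  congr 1
  ring

theorem prod_pairs_le (hP : P.IsSymm) (hP1 : ∀ i j, P i j < 1) (τ : V → ι) (S : Finset V) :
    ∏ e ∈ pairs S, (1 - blockProb hP τ e) ≤
      Real.exp (-(1 / 2 * quad P (fun i => blockCount τ S i)) + logBound P / 2 * S.card) := by
  have hsum : ∑ u ∈ S, -Real.log (1 - P (τ u) (τ u)) ≤ S.card • logBound P :=
    Finset.sum_le_card_nsmul _ _ _ fun u _ => neg_log_le_logBound _ _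
  rw [prod_pairs_eq_exp hP hP1, Real.exp_le_exp]
  rw [nsmul_eq_mul] at hsum
  linarith

theorem le_prod_pairs (hP : P.IsSymm) (hP01 : ∀ i j, P i j ∈ Set.Ico (0 : ℝ) 1) (τ : V → ι)
    (S : Finset V) :
    Real.exp (-(1 / 2 * quad P (fun i => blockCount τ S i))) ≤
      ∏ e ∈ pairs S, (1 - blockProb hP τ e) := by
  have hsum : 0 ≤ ∑ u ∈ S, -Real.log (1 - P (τ u) (τ u)) := Finset.sum_nonneg fun u _ =>
    neg_nonneg.2 (Real.log_nonpos (sub_nonneg.2 (hP01 _ _).2.le) (sub_le_self _ (hP01 _ _).1))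
  rw [prod_pairs_eq_exp hP fun i j => (hP01 i j).2, Real.exp_le_exp]
  linarith

end

variable [Fintype V]

/-- The random graph on `V` in which the pair `uv` is an edge with the probability `p_ij` determined
by the blocks `i = τ u` and `j = τ v`; it generalizes `law`, the blocks being allowed arbitrary
sizes. -/
noncomputable def blockGraph (hP : P.IsSymm) (τ : V → ι) : Measure (SimpleGraph V) :=
  randomGraph fun e => Set.projIcc (0 : ℝ) 1 zero_le_one (blockProb hP τ e)

instance (hP : P.IsSymm) (τ : V → ι) : IsProbabilityMeasure (blockGraph hP τ) := by
  unfold blockGraph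
  infer_instance

variable [DecidableEq V]

theorem blockGraph_real_isIndepSet (hP : P.IsSymm) (hP01 : ∀ i j, P i j ∈ Set.Icc (0 : ℝ) 1)
    (τ : V → ι) (S : Finset V) :
    (blockGraph hP τ).real {G | G.IsIndepSet (S : Set V)} =
      ∏ e ∈ pairs S, (1 - blockProb hP τ e) := by
  simpa only [coe_projIcc_blockProb hP hP01, blockGraph] using
    measureReal_isIndepSet (fun e => Set.projIcc (0 : ℝ) 1 zero_le_one (blockProb hP τ e)) S

theorem blockGraph_real_forall_not_isIndepSet_le (hP : P.IsSymm)
    (hP01 : ∀ i j, P i j ∈ Set.Icc (0 : ℝ) 1) (τ : V → ι) {κ : Type*} [Fintype κ]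
    (S : κ → Finset V) {Δ : ℝ} (hΔ0 : 0 < Δ)
    (hΔ : ∑ i, ∑ j with ¬Disjoint (pairs (S i)) (pairs (S j)),
      ∏ e ∈ pairs (S i) ∪ pairs (S j), (1 - blockProb hP τ e) ≤ Δ) :
    (blockGraph hP τ).real {G | ∀ i, ¬G.IsIndepSet (S i : Set V)} ≤
      Real.exp (-((∑ i, ∏ e ∈ pairs (S i), (1 - blockProb hP τ e)) ^ 2 / (2 * Δ))) := by
  simpa only [coe_projIcc_blockProb hP hP01, blockGraph] using measureReal_forall_not_isIndepSet_le
    (fun e => Set.projIcc (0 : ℝ) 1 zero_le_one (blockProb hP τ e)) S hΔ0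
    (by simpa only [coe_projIcc_blockProb hP hP01] using hΔ)

end BlockGraph

section Law

variable {k : ℕ} {α : Fin k → ℝ} {P : Matrix (Fin k) (Fin k) ℝ}

theorem law_eq_blockGraph (hP : P.IsSymm) (n : ℕ) :
    law α P hP n = blockGraph hP (Sigma.fst : Vertex α n → Fin k) := rfl

theorem tendsto_law_one (hP : P.IsSymm) {Q : ∀ n, Set (SimpleGraph (Vertex α n))}
    (h : Tendsto (fun n => (law α P hP n).real (Q n)ᶜ) atTop (𝓝 0)) :
    Tendsto (fun n => law α P hP n (Q n)) atTop (𝓝 1) := by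
  simp only [law_eq_blockGraph] at h ⊢
  have hreal := h.const_sub 1
  simp only [probReal_compl_eq_one_sub (measurableSet_of_finite _), sub_sub_cancel,
    sub_zero] at hreal
  exact (ENNReal.tendsto_toReal_iff (fun _ => measure_ne_top _ _) ENNReal.one_ne_top).1
    (by simpa [measureReal_def] using hreal)

theorem sum_eq_one_of_oneNorm (hα : ∀ i, 0 ≤ α i) (hα1 : oneNorm α = 1) : ∑ i, α i = 1 :=
  (oneNorm_eq_sum hα).symm.trans hα1

theorem blockSize_castSucc {m : ℕ} (α : Fin (m + 1) → ℝ) (n : ℕ) (i : Fin m) :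
    blockSize α n i.castSucc = ⌊α i.castSucc * n⌋₊ := by
  simp [blockSize, i.2.ne]

theorem sum_floor_le {m : ℕ} {α : Fin (m + 1) → ℝ} (hα : ∀ i, 0 ≤ α i) (hα1 : ∑ i, α i = 1)
    (n : ℕ) : ∑ i : Fin m, (⌊α i.castSucc * n⌋₊ : ℝ) ≤ n - α (Fin.last m) * n := by
  rw [Fin.sum_univ_castSucc] at hα1
  calc ∑ i : Fin m, (⌊α i.castSucc * n⌋₊ : ℝ)
      ≤ ∑ i : Fin m, α i.castSucc * n :=
        Finset.sum_le_sum fun i _ => Nat.floor_le (mul_nonneg (hα _) n.cast_nonneg)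
    _ = _ := by rw [← Finset.sum_mul, eq_sub_of_add_eq hα1]; ring

theorem blockSize_last {m : ℕ} {α : Fin (m + 1) → ℝ} (hα : ∀ i, 0 ≤ α i) (hα1 : ∑ i, α i = 1)
    (n : ℕ) : (blockSize α n (Fin.last m) : ℝ) = n - ∑ i : Fin m, (⌊α i.castSucc * n⌋₊ : ℝ) := by
  have hle : ∑ i : Fin m, ⌊α i.castSucc * n⌋₊ ≤ n := by
    have := sum_floor_le hα hα1 n
    exact_mod_cast this.trans (sub_le_self _ (mul_nonneg (hα _) n.cast_nonneg))
  rw [blockSize, if_pos (by simp), Finset.sum_filter, Fin.sum_univ_castSucc]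
  simp [Nat.cast_sub hle]

theorem sum_blockSize (hα : ∀ i, 0 ≤ α i) (hα1 : ∑ i, α i = 1) (n : ℕ) :
    ∑ i, (blockSize α n i : ℝ) = n := by
  cases k with
  | zero => simp at hα1
  | succ m =>
    rw [Fin.sum_univ_castSucc, blockSize_last hα hα1]
    simp only [blockSize_castSucc, add_sub_cancel]

theorem card_vertex (hα : ∀ i, 0 ≤ α i) (hα1 : ∑ i, α i = 1) (n : ℕ) :
    Fintype.card (Vertex α n) = n := by
  have := sum_blockSize hα hα1 n
  simp only [Fintype.card_sigma, Fintype.card_fin]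
  exact_mod_cast this

theorem le_blockSize (hα : ∀ i, 0 ≤ α i) (hα1 : ∑ i, α i = 1) (n : ℕ) (i : Fin k) :
    α i * n - 1 ≤ blockSize α n i := by
  cases k with
  | zero => exact i.elim0
  | succ m =>
    cases i using Fin.lastCases with
    | last =>
      rw [blockSize_last hα hα1]
      linarith [sum_floor_le hα hα1 n]
    | cast i =>
      rw [blockSize_castSucc]
      exact (Nat.sub_one_lt_floor _).le

theorem blockSize_le (hα : ∀ i, 0 ≤ α i) (hα1 : ∑ i, α i = 1) (n : ℕ) (i : Fin k) :
    blockSize α n i ≤ α i * n + k := by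
  have hothers : ∑ j ∈ Finset.univ.erase i, (α j * n - 1) ≤
      ∑ j ∈ Finset.univ.erase i, (blockSize α n j : ℝ) :=
    Finset.sum_le_sum fun j _ => le_blockSize hα hα1 n j
  have htotal : ∑ j, (α j * n - 1) = n - k := by
    rw [Finset.sum_sub_distrib, ← Finset.sum_mul, hα1]
    simp
  rw [← Finset.add_sum_erase _ _ (Finset.mem_univ i)] at htotal
  have hsize := sum_blockSize hα hα1 n
  rw [← Finset.add_sum_erase _ _ (Finset.mem_univ i)] at hsize
  linarith

end Law

section LargeTypes

variable {ι V : Type*} [Fintype ι] [DecidableEq ι]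

/-- The independent sets of `G` have at most the size at which the expected number of independent
sets of their type, with `N` in place of `log n`, drops below one. In units of `N` their types are
then admissible. -/
def QuadBounded (P : Matrix ι ι ℝ) (τ : V → ι) (N : ℝ) (G : SimpleGraph V) : Prop :=
  ∀ S : Finset V, G.IsIndepSet (S : Set V) →
    quad P (fun i => blockCount τ S i) ≤ 2 * N * S.card

variable [Fintype V]

theorem sum_nonempty_pow_card_le {x : ℝ} (hx : 0 ≤ x) :
    ∑ S : Finset V with S.Nonempty, x ^ S.card ≤ Real.exp (Fintype.card V * x) - 1 := by
  classical
  have hbinomial : ∑ S : Finset V, x ^ S.card = (x + 1) ^ Fintype.card V := by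
    simpa using Fintype.sum_pow_mul_eq_add_pow V x 1
  have hsplit := Finset.sum_filter_add_sum_filter_not Finset.univ (Finset.Nonempty (α := V))
    fun S => x ^ S.card
  simp only [Finset.not_nonempty_iff_eq_empty, Finset.filter_eq', Finset.mem_univ, if_true,
    Finset.sum_singleton, Finset.card_empty, pow_zero] at hsplit
  have hpow : (x + 1) ^ Fintype.card V ≤ Real.exp (Fintype.card V * x) := by
    rw [Real.exp_nat_mul]
    exact pow_le_pow_left₀ (by positivity) (Real.add_one_le_exp x) _
  linarith

theorem blockGraph_real_not_quadBounded_le {P : Matrix ι ι ℝ} (hP : P.IsSymm)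
    (hP01 : ∀ i j, P i j ∈ Set.Ico (0 : ℝ) 1) (τ : V → ι) (N : ℝ) :
    (blockGraph hP τ).real {G | ¬QuadBounded P τ N G} ≤
      Real.exp (Fintype.card V * Real.exp (-N + logBound P / 2)) - 1 := by
  classical
  let T := Finset.univ.filter fun S : Finset V =>
    2 * N * S.card < quad P fun i => blockCount τ S i
  have hT : T ⊆ Finset.univ.filter Finset.Nonempty := fun S hS => by
    refine Finset.mem_filter.2 ⟨Finset.mem_univ _, Finset.nonempty_iff_ne_empty.2 ?_⟩
    rintro rfl
    simp [T, blockCount, quad] at hS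
  calc (blockGraph hP τ).real {G | ¬QuadBounded P τ N G}
      ≤ (blockGraph hP τ).real (⋃ S ∈ T, {G | G.IsIndepSet (S : Set V)}) :=
        measureReal_mono (fun G hG => by simpa [QuadBounded, T, and_comm] using hG)
          (measure_ne_top _ _)
    _ ≤ ∑ S ∈ T, (blockGraph hP τ).real {G | G.IsIndepSet (S : Set V)} :=
        measureReal_biUnion_finset_le _ _
    _ ≤ ∑ S ∈ T, Real.exp (-N + logBound P / 2) ^ S.card := Finset.sum_le_sum fun S hS => by
        rw [blockGraph_real_isIndepSet hP fun i j => Set.Ico_subset_Icc_self (hP01 i j),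
          ← Real.exp_nat_mul]
        refine (prod_pairs_le hP (fun i j => (hP01 i j).2) τ S).trans (Real.exp_le_exp.2 ?_)
        linarith [(Finset.mem_filter.1 hS).2]
    _ ≤ ∑ S : Finset V with S.Nonempty, Real.exp (-N + logBound P / 2) ^ S.card :=
        Finset.sum_le_sum_of_subset_of_nonneg hT fun _ _ _ => by positivity
    _ ≤ _ := sum_nonempty_pow_card_le (Real.exp_pos _).le

end LargeTypes

section LowerBound

variable {k : ℕ} {α : Fin k → ℝ} {P : Matrix (Fin k) (Fin k) ℝ}

theorem blockCount_filter {V : Type*} (τ : V → Fin k) (S : Finset V) (I : Finset (Fin k)) :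
    (fun i => (blockCount τ (S.filter fun u => τ u ∈ I) i : ℝ)) =
      Set.indicator I fun i => (blockCount τ S i : ℝ) := by
  funext i
  rw [Set.indicator_apply, blockCount, Finset.filter_filter]
  split_ifs with hi
  · congr 2
    exact Finset.filter_congr fun u _ => ⟨And.right, fun h => ⟨h ▸ hi, h⟩⟩
  · rw [Nat.cast_eq_zero, Finset.card_eq_zero, Finset.filter_eq_empty_iff]
    rintro u _ ⟨hu, rfl⟩
    exact hi hu

theorem QuadBounded.smul_blockCount_mem_admissible {V : Type*} {τ : V → Fin k} {N : ℝ}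
    {G : SimpleGraph V} (hG : QuadBounded P τ N G) (hN : 0 < N) {S : Finset V}
    (hS : G.IsIndepSet (S : Set V)) :
    N⁻¹ • (fun i => (blockCount τ S i : ℝ)) ∈ admissible P := by
  refine ⟨fun i => mul_nonneg (inv_nonneg.2 hN.le) (Nat.cast_nonneg _), fun I _ => ?_⟩
  let S' := S.filter fun u => τ u ∈ I
  have hS' : quad P (fun i => blockCount τ S' i) ≤ 2 * N * S'.card :=
    hG S' (hS.mono (Finset.coe_subset.2 (Finset.filter_subset _ _)))
  have hrestrict : Set.indicator I (N⁻¹ • fun i => (blockCount τ S i : ℝ)) =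
      N⁻¹ • fun i => (blockCount τ S' i : ℝ) := by
    rw [blockCount_filter]
    exact Set.indicator_const_smul (I : Set (Fin k)) N⁻¹ _
  rw [← g_indicator, hrestrict, g_univ, quad_smul]
  simp only [Pi.smul_apply, smul_eq_mul, ← Finset.mul_sum, sum_blockCount]
  calc 0 = N⁻¹ * S'.card - 1 / 2 * (N⁻¹ ^ 2 * (2 * N * S'.card)) := by field_simp; ring
    _ ≤ _ := by gcongr

theorem QuadBounded.smul_blockCount_univ_mem_convexHull {V : Type*} [Fintype V] {τ : V → Fin k}
    {N : ℝ} {G : SimpleGraph V} (hG : QuadBounded P τ N G) (hN : 0 < N) {q : ℕ} (hq : 0 < q)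
    (hcol : G.Colorable q) :
    (N * q)⁻¹ • (fun i => (blockCount τ Finset.univ i : ℝ)) ∈ convexHull ℝ (admissible P) := by
  classical
  obtain ⟨C⟩ := hcol
  let colorClass (l : Fin q) : Finset V := Finset.univ.filter fun v => C v = l
  have hclass (l : Fin q) : N⁻¹ • (fun i => (blockCount τ (colorClass l) i : ℝ)) ∈
      convexHull ℝ (admissible P) :=
    subset_convexHull ℝ _ (hG.smul_blockCount_mem_admissible hN fun u hu v hv _ hadj =>
      C.valid hadj (by simp_all [colorClass]))
  have hcount (i : Fin k) :
      (blockCount τ Finset.univ i : ℝ) = ∑ l, (blockCount τ (colorClass l) i : ℝ) := by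
    rw [blockCount, Finset.card_eq_sum_card_fiberwise (f := C) (t := Finset.univ) (by simp),
      Nat.cast_sum]
    simp only [blockCount, colorClass, Finset.filter_filter, and_comm]
  have hmean := (convex_convexHull ℝ (admissible P)).sum_mem (t := Finset.univ)
    (w := fun _ : Fin q => (q : ℝ)⁻¹) (fun _ _ => by positivity) (by simp [hq.ne'])
    fun l _ => hclass l
  convert hmean using 1
  funext i
  simp only [Pi.smul_apply, smul_eq_mul, Finset.sum_apply, ← Finset.mul_sum, hcount, mul_inv]
  ring

theorem QuadBounded.le_cStar_mul_chi {V : Type} [Fintype V] [Nonempty V] {τ : V → Fin k} {N : ℝ}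
    {G : SimpleGraph V} (hG : QuadBounded P τ N G) (hα : ∀ i, 0 ≤ α i) (hα1 : oneNorm α = 1)
    (hP1 : ∀ i, P i i < 1) (hPd : ∀ i, 0 < P i i) (hN : 0 < N) {r : ℝ} (hr : 0 ≤ r)
    (hsize : ∀ i, r * α i ≤ blockCount τ Finset.univ i) :
    r ≤ cStar α P * (N * chi G) := by
  have hcol : G.Colorable G.chromaticNumber.toNat := G.colorable_chromaticNumber_of_fintype
  have hq : 0 < G.chromaticNumber.toNat := by
    obtain ⟨C⟩ := hcol
    exact (Nat.zero_le _).trans_lt (C (Classical.arbitrary V)).2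
  have hpos : 0 < N * chi G := mul_pos hN (Nat.cast_pos.2 hq)
  rw [← div_le_iff₀ hpos]
  refine le_cStar hα1 hPd hP1 (by positivity) (mem_convexHull_admissible_of_le
    (fun i => (hPd i).le) hP1 (hG.smul_blockCount_univ_mem_convexHull hN hq hcol) (fun i => ?_)
    fun i => ?_)
  · exact mul_nonneg (by positivity) (hα i)
  · rw [Pi.smul_apply, Pi.smul_apply, smul_eq_mul, smul_eq_mul, div_eq_inv_mul, mul_assoc]
    exact mul_le_mul_of_nonneg_left (hsize i) (inv_nonneg.2 hpos.le)

theorem tendsto_log_natCast : Tendsto (fun n : ℕ => Real.log n) atTop atTop :=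
  Real.tendsto_log_atTop.comp tendsto_natCast_atTop_atTop

theorem tendsto_exp_natCast_mul_exp_sub_one {δ : ℝ} (hδ : 0 < δ) (b : ℝ) :
    Tendsto (fun n : ℕ => Real.exp (n * Real.exp (-((1 + δ) * Real.log n) + b)) - 1)
      atTop (𝓝 0) := by
  have hexponent : Tendsto (fun n : ℕ => -(δ * Real.log n) + b) atTop atBot :=
    tendsto_atBot_add_const_right _ _
      (tendsto_neg_atTop_atBot.comp (tendsto_log_natCast.const_mul_atTop hδ))
  have hlim := ((Real.continuous_exp.tendsto 0).comp
    (Real.tendsto_exp_atBot.comp hexponent)).sub_const 1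
  rw [Real.exp_zero, sub_self] at hlim
  refine hlim.congr' ?_
  filter_upwards [eventually_gt_atTop 0] with n hn
  have hsplit : -((1 + δ) * Real.log n) + b = -Real.log n + (-(δ * Real.log n) + b) := by ring
  have hn0 : (0 : ℝ) < n := Nat.cast_pos.2 hn
  simp only [Function.comp_apply]
  rw [hsplit, Real.exp_add (-Real.log n), Real.exp_neg, Real.exp_log hn0,
    mul_inv_cancel_left₀ hn0.ne']

theorem eventually_mul_le_blockSize (hα : ∀ i, 0 < α i) (hα1 : ∑ i, α i = 1) {ε : ℝ} (hε : 0 < ε) :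
    ∀ᶠ n : ℕ in atTop, ∀ i, (1 - ε) * n * α i ≤ blockSize α n i := by
  refine eventually_all.2 fun i => ?_
  have hlim := (tendsto_natCast_atTop_atTop (R := ℝ)).const_mul_atTop (mul_pos hε (hα i))
  filter_upwards [hlim.eventually_ge_atTop 1] with n hn
  linarith [le_blockSize (fun i => (hα i).le) hα1 n i]

theorem tendsto_law_chi_lt (hα : ∀ i, 0 < α i) (hα1 : oneNorm α = 1) (hP : P.IsSymm)
    (hP01 : ∀ i j, P i j ∈ Set.Ico (0 : ℝ) 1) (hPd : ∀ i, 0 < P i i) {ε : ℝ} (hε : 0 < ε) :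
    Tendsto (fun n : ℕ => (law α P hP n).real
      {G | chi G < (1 - ε) * (n / (cStar α P * Real.log n))}) atTop (𝓝 0) := by
  have hα0 : ∀ i, 0 ≤ α i := fun i => (hα i).le
  have hsum := sum_eq_one_of_oneNorm hα0 hα1
  have hP1 : ∀ i, P i i < 1 := fun i => (hP01 i i).2
  have hc := cStar_pos hα0 hα1 hPd hP1
  refine squeeze_zero' (.of_forall fun n => measureReal_nonneg) ?_
    (tendsto_exp_natCast_mul_exp_sub_one (half_pos hε) (logBound P / 2))
  filter_upwards [eventually_mul_le_blockSize hα hsum (half_pos hε), eventually_ge_atTop 2]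
    with n hsize hn
  have hlog : 0 < Real.log n := Real.log_pos (by exact_mod_cast hn)
  have : Nonempty (Vertex α n) := Fintype.card_pos_iff.1 (by rw [card_vertex hα0 hsum]; omega)
  have hbound := blockGraph_real_not_quadBounded_le hP hP01 (Sigma.fst : Vertex α n → Fin k)
    ((1 + ε / 2) * Real.log n)
  rw [card_vertex hα0 hsum] at hbound
  rw [law_eq_blockGraph]
  refine (measureReal_mono (fun G hG hquad => ?_) (measure_ne_top _ _)).trans hbound
  refine absurd (Set.mem_ofPred.1 hG) (not_lt.2 ?_)
  rcases le_total 1 ε with hε1 | hε1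
  · exact (mul_nonpos_of_nonpos_of_nonneg (by linarith) (by positivity)).trans (Nat.cast_nonneg _)
  have hle := hquad.le_cStar_mul_chi hα0 hα1 hP1 hPd (by positivity)
    (r := (1 - ε / 2) * n) (mul_nonneg (by linarith) n.cast_nonneg)
    (by simpa only [blockCount_sigma_univ] using hsize)
  rw [mul_div_assoc', div_le_iff₀ (by positivity)]
  have hε2 : (1 - ε) * n * (1 + ε / 2) ≤ (1 - ε / 2) * n := by
    nlinarith [mul_nonneg (sq_nonneg ε) (Nat.cast_nonneg (α := ℝ) n)]
  refine le_of_mul_le_mul_right (hε2.trans (hle.trans_eq ?_)) (by positivity : 0 < 1 + ε / 2)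
  ring

end LowerBound

section Agreement

variable {K : Type*} [Fintype K] [DecidableEq K] {r : ℕ}

/-- The indices at which two choice functions agree; the corresponding transversals overlap
exactly there. -/
def agreement (f f' : K → Fin r) : Finset K := Finset.univ.filter fun κ => f' κ = f κ

theorem card_filter_subset_agreement (f : K → Fin r) (D : Finset K) :
    (Finset.univ.filter fun f' : K → Fin r => D ⊆ agreement f f').card =
      r ^ (Fintype.card K - D.card) := by
  have hpi : (Finset.univ.filter fun f' : K → Fin r => D ⊆ agreement f f') =
      Fintype.piFinset fun κ => if κ ∈ D then {f κ} else Finset.univ := by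
    ext f'
    simp only [agreement, Finset.subset_iff, Finset.mem_filter, Finset.mem_univ, true_and,
      Fintype.mem_piFinset]
    refine forall_congr' fun κ => ?_
    split_ifs with h <;> simp [h]
  have hcard (κ : K) : (if κ ∈ D then {f κ} else Finset.univ : Finset (Fin r)).card =
      if κ ∈ Dᶜ then r else 1 := by
    by_cases h : κ ∈ D <;> simp [h]
  simp only [hpi, Fintype.card_piFinset, hcard]
  rw [Finset.prod_ite_mem, Finset.univ_inter, Finset.prod_const, Finset.card_compl]

theorem sum_agreement_le (hr : 0 < r) {w : Finset K → ℝ} (hw : ∀ D, 0 ≤ w D) (f : K → Fin r) :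
    ∑ f' with 2 ≤ (agreement f f').card, w (agreement f f') ≤
      (r : ℝ) ^ Fintype.card K * ∑ D : Finset K with 2 ≤ D.card, w D / (r : ℝ) ^ D.card := by
  have hr0 : (r : ℝ) ≠ 0 := Nat.cast_ne_zero.2 hr.ne'
  have hterm (f' : K → Fin r) (D : Finset K) : 0 ≤ if D ⊆ agreement f f' then w D else 0 := by
    split_ifs
    exacts [hw D, le_rfl]
  have hsingle (f' : K → Fin r) (hf' : 2 ≤ (agreement f f').card) : w (agreement f f') ≤
      ∑ D : Finset K with 2 ≤ D.card, if D ⊆ agreement f f' then w D else 0 := by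
    have := Finset.single_le_sum (f := fun D => if D ⊆ agreement f f' then w D else 0)
      (s := Finset.univ.filter fun D => 2 ≤ D.card) (fun D _ => hterm f' D)
      (Finset.mem_filter.2 ⟨Finset.mem_univ (agreement f f'), hf'⟩)
    rwa [if_pos subset_rfl] at this
  have hcount (D : Finset K) : ∑ f', (if D ⊆ agreement f f' then w D else 0) =
      (r : ℝ) ^ Fintype.card K * (w D / (r : ℝ) ^ D.card) := by
    rw [← Finset.sum_filter, Finset.sum_const, card_filter_subset_agreement, nsmul_eq_mul,
      Nat.cast_pow, pow_sub₀ _ hr0 (Finset.card_le_univ D)]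
    ring
  calc ∑ f' with 2 ≤ (agreement f f').card, w (agreement f f')
      ≤ ∑ f' with 2 ≤ (agreement f f').card, ∑ D : Finset K with 2 ≤ D.card,
          if D ⊆ agreement f f' then w D else 0 :=
        Finset.sum_le_sum fun f' hf' => hsingle f' (Finset.mem_filter.1 hf').2
    _ ≤ ∑ f', ∑ D : Finset K with 2 ≤ D.card, if D ⊆ agreement f f' then w D else 0 :=
        Finset.sum_le_sum_of_subset_of_nonneg (Finset.filter_subset _ _) fun f' _ _ =>
          Finset.sum_nonneg fun D _ => hterm f' D
    _ = (r : ℝ) ^ Fintype.card K * ∑ D : Finset K with 2 ≤ D.card, w D / (r : ℝ) ^ D.card := by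
        rw [Finset.sum_comm, Finset.mul_sum]
        exact Finset.sum_congr rfl fun D _ => hcount D

end Agreement

section Transversals

theorem pairs_inter {X : Type*} [DecidableEq X] (S T : Finset X) :
    pairs S ∩ pairs T = pairs (S ∩ T) := by
  ext e
  induction e with
  | _ u v =>
    simp only [Finset.mem_inter, mk_mem_pairs]
    tauto

theorem pairs_image {X Y : Type*} [DecidableEq X] [DecidableEq Y] {φ : X → Y} (hφ : φ.Injective)
    (S : Finset X) : pairs (S.image φ) = (pairs S).image (Sym2.map φ) := by
  rw [pairs, pairs, Finset.sym2_image, Finset.filter_image]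
  simp only [Sym2.isDiag_map hφ]

variable {K V : Type*} {r : ℕ}

theorem injective_select {φ : K × Fin r → V} (hφ : φ.Injective) (f : K → Fin r) :
    Function.Injective fun κ => φ (κ, f κ) :=
  fun _ _ h => congrArg Prod.fst (hφ h)

variable [DecidableEq V]

/-- The set that `f` selects from the cells `φ (κ, ·)` with `κ ∈ D`, one element from each. -/
def transversal (φ : K × Fin r → V) (f : K → Fin r) (D : Finset K) : Finset V :=
  D.image fun κ => φ (κ, f κ)

variable {φ : K × Fin r → V}

theorem card_transversal (hφ : φ.Injective) (f : K → Fin r) (D : Finset K) :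
    (transversal φ f D).card = D.card :=
  Finset.card_image_of_injective _ (injective_select hφ f)

theorem transversal_inter [Fintype K] (hφ : φ.Injective) (f f' : K → Fin r) :
    transversal φ f Finset.univ ∩ transversal φ f' Finset.univ =
      transversal φ f (agreement f f') := by
  ext v
  simp only [transversal, agreement, Finset.mem_inter, Finset.mem_image, Finset.mem_univ,
    true_and, Finset.mem_filter]
  constructor
  · rintro ⟨⟨κ, rfl⟩, κ', h⟩
    obtain ⟨rfl, hf⟩ := Prod.mk.inj (hφ h)
    exact ⟨κ', hf, rfl⟩
  · rintro ⟨κ, h, rfl⟩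
    exact ⟨⟨κ, rfl⟩, κ, by rw [h]⟩

theorem two_le_card_agreement [Fintype K] (hφ : φ.Injective) {f f' : K → Fin r}
    (h : ¬Disjoint (pairs (transversal φ f Finset.univ)) (pairs (transversal φ f' Finset.univ))) :
    2 ≤ (agreement f f').card := by
  rw [Finset.not_disjoint_iff_nonempty_inter, pairs_inter, transversal_inter hφ] at h
  obtain ⟨e, he⟩ := h
  induction e with
  | _ u v =>
    rw [mk_mem_pairs] at he
    rw [← card_transversal hφ f]
    exact Finset.one_lt_card.2 ⟨u, he.1, v, he.2.1, he.2.2⟩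

variable {ι : Type*} {β : V → ι} {τ : K → ι}

theorem blockCount_transversal [DecidableEq ι] (hφ : φ.Injective)
    (hβ : ∀ x, β (φ x) = τ x.1) (f : K → Fin r) (D : Finset K) (i : ι) :
    blockCount β (transversal φ f D) i = blockCount τ D i := by
  unfold blockCount transversal
  rw [Finset.filter_image, Finset.card_image_of_injective _ (injective_select hφ f)]
  simp only [hβ]

variable {P : Matrix ι ι ℝ}

theorem prod_pairs_transversal [DecidableEq K] (hP : P.IsSymm) (hφ : φ.Injective)
    (hβ : ∀ x, β (φ x) = τ x.1) (f : K → Fin r) (D : Finset K) :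
    ∏ e ∈ pairs (transversal φ f D), (1 - blockProb hP β e) =
      ∏ e ∈ pairs D, (1 - blockProb hP τ e) := by
  have hselect := injective_select hφ f
  rw [transversal, pairs_image hselect, Finset.prod_image (Sym2.map.injective hselect).injOn]
  refine Finset.prod_congr rfl fun e _ => ?_
  induction e with
  | _ κ κ' => rw [Sym2.map_mk, blockProb_mk, blockProb_mk, hβ, hβ]

variable [Fintype ι] [DecidableEq ι] [Fintype K]

theorem prod_union_transversal_le [DecidableEq K] (hP : P.IsSymm)
    (hP01 : ∀ i j, P i j ∈ Set.Ico (0 : ℝ) 1)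
    (hφ : φ.Injective) (hβ : ∀ x, β (φ x) = τ x.1) (f f' : K → Fin r) :
    ∏ e ∈ pairs (transversal φ f Finset.univ) ∪ pairs (transversal φ f' Finset.univ),
        (1 - blockProb hP β e) ≤
      (∏ e ∈ pairs (Finset.univ : Finset K), (1 - blockProb hP τ e)) ^ 2 *
        Real.exp (1 / 2 * quad P fun i => blockCount τ (agreement f f') i) := by
  have hP1 : ∀ i j, P i j < 1 := fun i j => (hP01 i j).2
  have hsplit := Finset.prod_union_inter (s₁ := pairs (transversal φ f Finset.univ))
    (s₂ := pairs (transversal φ f' Finset.univ)) (f := fun e => 1 - blockProb hP β e)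
  rw [pairs_inter, transversal_inter hφ, prod_pairs_transversal hP hφ hβ,
    prod_pairs_transversal hP hφ hβ, prod_pairs_transversal hP hφ hβ, ← pow_two] at hsplit
  rw [← hsplit, mul_assoc]
  refine le_mul_of_one_le_right (Finset.prod_nonneg fun e _ => sub_nonneg.2
    (blockProb_mem hP (I := Set.Iic 1) (fun i j => (hP1 i j).le) β e)) ?_
  calc (1 : ℝ) = Real.exp (-(1 / 2 * quad P fun i => blockCount τ (agreement f f') i)) *
        Real.exp (1 / 2 * quad P fun i => blockCount τ (agreement f f') i) := by
        rw [← Real.exp_add, neg_add_cancel, Real.exp_zero]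
    _ ≤ _ := mul_le_mul_of_nonneg_right (le_prod_pairs hP hP01 τ _) (Real.exp_pos _).le

theorem blockGraph_real_no_transversal_le [Fintype V] (hP : P.IsSymm)
    (hP01 : ∀ i j, P i j ∈ Set.Ico (0 : ℝ) 1) (hr : 0 < r) (hφ : φ.Injective)
    (hβ : ∀ x, β (φ x) = τ x.1) {R : ℝ} (hR0 : 0 < R)
    (hR : ∑ D : Finset K with 2 ≤ D.card,
      Real.exp (1 / 2 * quad P fun i => blockCount τ D i) / (r : ℝ) ^ D.card ≤ R) :
    (blockGraph hP β).real
        {G | ∀ f, ¬G.IsIndepSet (transversal φ f Finset.univ : Set V)} ≤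
      Real.exp (-(1 / (2 * R))) := by
  classical
  have hP1 : ∀ i j, P i j < 1 := fun i j => (hP01 i j).2
  let F (f : K → Fin r) : Finset (Sym2 V) := pairs (transversal φ f Finset.univ)
  set π := ∏ e ∈ pairs (Finset.univ : Finset K), (1 - blockProb hP τ e) with hπ
  have hπ0 : 0 < π := Finset.prod_pos fun e _ => sub_pos.2
    (blockProb_mem hP (I := Set.Iio 1) hP1 τ e)
  have hrow (f : K → Fin r) :
      ∑ f' with ¬Disjoint (F f) (F f'), ∏ e ∈ F f ∪ F f', (1 - blockProb hP β e) ≤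
        π ^ 2 * ((r : ℝ) ^ Fintype.card K * R) := by
    let w (D : Finset K) : ℝ := Real.exp (1 / 2 * quad P fun i => blockCount τ D i)
    calc _ ≤ ∑ f' with ¬Disjoint (F f) (F f'), π ^ 2 * w (agreement f f') :=
          Finset.sum_le_sum fun f' _ => prod_union_transversal_le hP hP01 hφ hβ f f'
      _ ≤ ∑ f' with 2 ≤ (agreement f f').card, π ^ 2 * w (agreement f f') :=
          Finset.sum_le_sum_of_subset_of_nonneg
            (Finset.monotone_filter_right _ fun f' _ => two_le_card_agreement hφ)
            fun f' _ _ => by positivity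
      _ ≤ _ := by
          rw [← Finset.mul_sum]
          gcongr
          exact (sum_agreement_le hr (w := w) (fun D => (Real.exp_pos _).le) f).trans
            (mul_le_mul_of_nonneg_left hR (by positivity))
  have hcard : (Fintype.card (K → Fin r) : ℝ) = (r : ℝ) ^ Fintype.card K := by simp
  have hjanson := blockGraph_real_forall_not_isIndepSet_le hP
    (fun i j => Set.Ico_subset_Icc_self (hP01 i j)) β
    (fun f : K → Fin r => transversal φ f Finset.univ)
    (Δ := (r : ℝ) ^ Fintype.card K * (π ^ 2 * ((r : ℝ) ^ Fintype.card K * R))) (by positivity)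
    ((Finset.sum_le_sum fun f _ => hrow f).trans_eq (by simp))
  refine hjanson.trans_eq ?_
  simp only [prod_pairs_transversal hP hφ hβ, ← hπ, Finset.sum_const, nsmul_eq_mul,
    Finset.card_univ, hcard]
  congr 2
  field_simp

end Transversals

section Estimate

theorem sub_mul_le_of_le_of_le {M η L d x : ℝ} (hM : 0 ≤ M) (hη : 0 < η) (hη1 : η ≤ 1 / 2)
    (hL : 0 < L) (hd : 2 ≤ d) (hx : x ≤ M * d ^ 2) (hx' : x ≤ (1 - η) * L * d) :
    x - d * ((1 - η / 8) * L) ≤ M * (6 / η) ^ 2 - 3 / 2 * L + d * -(η * L / 4) := by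
  rcases le_or_gt d (6 / η) with h | h
  · have hsq : M * d ^ 2 ≤ M * (6 / η) ^ 2 := by gcongr
    have hlin : 3 / 2 * L ≤ d * (1 - 3 * η / 8) * L :=
      mul_le_mul_of_nonneg_right (by nlinarith) hL.le
    linarith
  · rw [div_lt_iff₀ hη] at h
    have hsq : 0 ≤ M * (6 / η) ^ 2 := by positivity
    have hlin : 3 / 2 * L ≤ 5 / 8 * (d * η) * L := mul_le_mul_of_nonneg_right (by linarith) hL.le
    linarith

theorem sum_exp_div_pow_le {K : Type*} [Fintype K] {q : Finset K → ℝ}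
    {M η L r : ℝ} (hM : 0 ≤ M) (hη : 0 < η) (hη1 : η ≤ 1 / 2) (hL : 0 < L)
    (hq : ∀ D, q D ≤ M * (D.card : ℝ) ^ 2) (hq' : ∀ D, q D ≤ (1 - η) * L * D.card)
    (hcard : (Fintype.card K : ℝ) ≤ Real.exp (η * L / 4)) (hr : Real.exp ((1 - η / 8) * L) ≤ r) :
    ∑ D : Finset K with 2 ≤ D.card, Real.exp (q D) / r ^ D.card ≤
      Real.exp (M * (6 / η) ^ 2 + 1 - 3 / 2 * L) := by
  set C := Real.exp (M * (6 / η) ^ 2 - 3 / 2 * L) with hC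
  set y := Real.exp (-(η * L / 4)) with hy
  have hterm : ∀ D ∈ Finset.univ.filter (fun D : Finset K => 2 ≤ D.card),
      Real.exp (q D) / r ^ D.card ≤ C * y ^ D.card := fun D hD => by
    have hd : (2 : ℝ) ≤ D.card := by exact_mod_cast (Finset.mem_filter.1 hD).2
    calc Real.exp (q D) / r ^ D.card
        ≤ Real.exp (q D) / Real.exp ((1 - η / 8) * L) ^ D.card := by gcongr
      _ = Real.exp (q D - D.card * ((1 - η / 8) * L)) := by
          rw [← Real.exp_nat_mul, ← Real.exp_sub]
      _ ≤ Real.exp (M * (6 / η) ^ 2 - 3 / 2 * L + D.card * -(η * L / 4)) :=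
          Real.exp_le_exp.2 (sub_mul_le_of_le_of_le hM hη hη1 hL hd (hq D) (hq' D))
      _ = C * y ^ D.card := by rw [Real.exp_add, Real.exp_nat_mul]
  have hpow : (y + 1) ^ Fintype.card K ≤ Real.exp 1 := by
    calc (y + 1) ^ Fintype.card K ≤ Real.exp y ^ Fintype.card K :=
          pow_le_pow_left₀ (by positivity) (Real.add_one_le_exp y) _
      _ = Real.exp (Fintype.card K * y) := (Real.exp_nat_mul _ _).symm
      _ ≤ Real.exp 1 := Real.exp_le_exp.2 (by
          rw [hy, Real.exp_neg, ← div_eq_mul_inv]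
          exact (div_le_one (Real.exp_pos _)).2 hcard)
  calc _ ≤ ∑ D : Finset K with 2 ≤ D.card, C * y ^ D.card := Finset.sum_le_sum hterm
    _ ≤ ∑ D : Finset K, C * y ^ D.card :=
        Finset.sum_le_sum_of_subset_of_nonneg (Finset.filter_subset _ _) fun D _ _ => by positivity
    _ = C * (y + 1) ^ Fintype.card K := by
        rw [← Finset.mul_sum, ← Fintype.sum_pow_mul_eq_add_pow]
        simp only [one_pow, mul_one]
    _ ≤ C * Real.exp 1 := mul_le_mul_of_nonneg_left hpow (Real.exp_pos _).le
    _ = _ := by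
        rw [hC, ← Real.exp_add]
        congr 1
        ring

end Estimate

section Extraction

variable {ι V : Type*} [DecidableEq ι]

/-- Every set of vertices with at least `s i * r` vertices in each part `i` contains an independent
set of type `s`, that is, one with exactly `s i` vertices in each part `i`. -/
def Extractable (β : V → ι) (s : ι → ℕ) (r : ℕ) (G : SimpleGraph V) : Prop :=
  ∀ U : Finset V, (∀ i, s i * r ≤ blockCount β U i) →
    ∃ S ⊆ U, G.IsIndepSet (S : Set V) ∧ ∀ i, blockCount β S i = s i

variable {β : V → ι} {s : ι → ℕ} {r : ℕ}

theorem exists_cells {U : Finset V} (hU : ∀ i, s i * r ≤ blockCount β U i) :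
    ∃ φ : ((i : ι) × Fin (s i)) × Fin r → V,
      φ.Injective ∧ (∀ x, β (φ x) = x.1.1) ∧ ∀ x, φ x ∈ U := by
  have hemb (i : ι) : Nonempty (Fin (s i) × Fin r ↪ {u // u ∈ U.filter fun u => β u = i}) :=
    Function.Embedding.nonempty_of_card_le (by simpa [blockCount] using hU i)
  have e := fun i => (hemb i).some
  have hmem (i : ι) (y : Fin (s i) × Fin r) : (e i y : V) ∈ U ∧ β (e i y) = i :=
    Finset.mem_filter.1 (e i y).2
  refine ⟨fun x => e x.1.1 (x.1.2, x.2), ?_, fun x => (hmem _ _).2, fun x => (hmem _ _).1⟩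
  rintro ⟨⟨i, x⟩, y⟩ ⟨⟨j, x'⟩, y'⟩ h
  obtain rfl : i = j := by simpa only [(hmem _ _).2] using congrArg β h
  obtain ⟨rfl, rfl⟩ := Prod.mk.inj ((e i).injective (Subtype.ext h))
  rfl

variable [Fintype ι] [Fintype V] {P : Matrix ι ι ℝ}

theorem blockGraph_real_not_extractable_le (hP : P.IsSymm)
    (hP01 : ∀ i j, P i j ∈ Set.Ico (0 : ℝ) 1) (hr : 0 < r) {R : ℝ} (hR0 : 0 < R)
    (hR : ∑ D : Finset ((i : ι) × Fin (s i)) with 2 ≤ D.card,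
      Real.exp (1 / 2 * quad P fun i => blockCount Sigma.fst D i) / (r : ℝ) ^ D.card ≤ R) :
    (blockGraph hP β).real {G | ¬Extractable β s r G} ≤
      (Fintype.card V : ℝ) ^ ((∑ i, s i) * r) * Real.exp (-(1 / (2 * R))) := by
  classical
  let T := Finset.univ.filter fun φ : ((i : ι) × Fin (s i)) × Fin r → V =>
    φ.Injective ∧ ∀ x, β (φ x) = x.1.1
  let noTransversal (φ : ((i : ι) × Fin (s i)) × Fin r → V) : Set (SimpleGraph V) :=
    {G | ∀ f, ¬G.IsIndepSet (transversal φ f Finset.univ : Set V)}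
  have hsub : {G | ¬Extractable β s r G} ⊆ ⋃ φ ∈ T, noTransversal φ := fun G hG => by
    by_contra hno
    refine hG fun U hU => ?_
    obtain ⟨φ, hφ, hβ, hφU⟩ := exists_cells hU
    have hφT : φ ∈ T := Finset.mem_filter.2 ⟨Finset.mem_univ _, hφ, hβ⟩
    obtain ⟨f, hf⟩ : ∃ f, G.IsIndepSet (transversal φ f Finset.univ : Set V) := by
      by_contra! h
      exact hno (Set.mem_biUnion hφT h)
    exact ⟨transversal φ f Finset.univ, Finset.image_subset_iff.2 fun κ _ => hφU _, hf, fun i => by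
      rw [blockCount_transversal hφ (τ := Sigma.fst) hβ, blockCount_sigma_univ]⟩
  have hT : T.card ≤ Fintype.card V ^ ((∑ i, s i) * r) :=
    (Finset.card_le_univ T).trans_eq (by simp)
  calc (blockGraph hP β).real {G | ¬Extractable β s r G}
      ≤ (blockGraph hP β).real (⋃ φ ∈ T, noTransversal φ) :=
        measureReal_mono hsub (measure_ne_top _ _)
    _ ≤ ∑ φ ∈ T, (blockGraph hP β).real (noTransversal φ) := measureReal_biUnion_finset_le _ _
    _ ≤ ∑ φ ∈ T, Real.exp (-(1 / (2 * R))) := Finset.sum_le_sum fun φ hφ =>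
        blockGraph_real_no_transversal_le hP hP01 hr (Finset.mem_filter.1 hφ).2.1
          (τ := Sigma.fst) (Finset.mem_filter.1 hφ).2.2 hR0 hR
    _ = T.card * Real.exp (-(1 / (2 * R))) := by rw [Finset.sum_const, nsmul_eq_mul]
    _ ≤ _ := by
        gcongr
        exact_mod_cast hT

end Extraction

section AdmissibleTypes

variable {k : ℕ} {P : Matrix (Fin k) (Fin k) ℝ} {a : Fin k → ℝ}

theorem quad_le_of_le_smul_admissible (hPd : ∀ i, 0 ≤ P i i) (hP1 : ∀ i, P i i < 1)
    (ha : a ∈ admissible P) {N : ℝ} (hN : 0 < N) {t : Fin k → ℝ} (ht : ∀ i, 0 ≤ t i)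
    (hta : ∀ i, t i ≤ N * a i) : 1 / 2 * quad P t ≤ N * ∑ i, t i := by
  have hmem : N⁻¹ • t ∈ admissible P :=
    mem_admissible_of_le hPd hP1 ha (fun i => mul_nonneg (inv_nonneg.2 hN.le) (ht i))
      fun i => (inv_mul_le_iff₀ hN).2 (hta i)
  have h := quad_le_of_mem_admissible hmem
  simp only [quad_smul, Pi.smul_apply, smul_eq_mul, ← Finset.mul_sum] at h
  calc 1 / 2 * quad P t = N ^ 2 / 2 * (N⁻¹ ^ 2 * quad P t) := by field_simp
    _ ≤ N ^ 2 / 2 * (2 * (N⁻¹ * ∑ i, t i)) := by gcongr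
    _ = N * ∑ i, t i := by field_simp

theorem blockGraph_real_not_extractable_le_of_mem_admissible {V : Type*} [Fintype V]
    {β : V → Fin k} {s : Fin k → ℕ} {r : ℕ} (hP : P.IsSymm)
    (hP01 : ∀ i j, P i j ∈ Set.Ico (0 : ℝ) 1) (ha : a ∈ admissible P) {η L : ℝ} (hη : 0 < η)
    (hη1 : η ≤ 1 / 2) (hL : 0 < L) (hs : ∀ i, (s i : ℝ) ≤ (1 - η) * L * a i)
    (hsum : ((∑ i, s i : ℕ) : ℝ) ≤ Real.exp (η * L / 4)) (hr : Real.exp ((1 - η / 8) * L) ≤ r) :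
    (blockGraph hP β).real {G | ¬Extractable β s r G} ≤
      (Fintype.card V : ℝ) ^ ((∑ i, s i) * r) *
        Real.exp (-(1 / (2 * Real.exp (logBound P / 2 * (6 / η) ^ 2 + 1 - 3 / 2 * L)))) := by
  have hr0 : 0 < r := Nat.cast_pos.1 ((Real.exp_pos _).trans_le hr)
  refine blockGraph_real_not_extractable_le hP hP01 hr0 (Real.exp_pos _)
    (sum_exp_div_pow_le (half_pos logBound_pos).le hη hη1 hL (fun D => ?_) (fun D => ?_)
      (by simpa using hsum) hr)
  · have h := quad_le (P := P) (t := fun i => (blockCount Sigma.fst D i : ℝ))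
      fun i => Nat.cast_nonneg _
    rw [sum_blockCount] at h
    linarith
  · rw [← sum_blockCount (Sigma.fst : (i : Fin k) × Fin (s i) → Fin k) D]
    refine quad_le_of_le_smul_admissible (fun i => (hP01 i i).1) (fun i => (hP01 i i).2) ha
      (mul_pos (by linarith) hL) (fun i => Nat.cast_nonneg _) fun i => le_trans ?_ (hs i)
    rw [← blockCount_sigma_univ s i]
    exact_mod_cast Finset.card_le_card (Finset.filter_subset_filter _ (Finset.subset_univ D))

end AdmissibleTypes

section Scales

theorem eventually_mul_pow_le_exp (C : ℝ) (m : ℕ) {b : ℝ} (hb : 0 < b) :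
    ∀ᶠ x : ℝ in atTop, C * x ^ m ≤ Real.exp (b * x) := by
  have h : (fun x : ℝ => C * x ^ m) =o[atTop] fun x => Real.exp (b * x) :=
    (isLittleO_pow_exp_pos_mul_atTop m hb).const_mul_left C
  filter_upwards [h.bound one_pos] with x hx
  rw [one_mul, Real.norm_of_nonneg (Real.exp_pos _).le] at hx
  exact (le_abs_self _).trans hx

theorem tendsto_pow_self_mul_exp_neg (B : ℝ) :
    Tendsto (fun n : ℕ => (n : ℝ) ^ n * Real.exp (-(1 / (2 * Real.exp (B - 3 / 2 * Real.log n)))))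
      atTop (𝓝 0) := by
  have hfactor : Tendsto (fun x => x - Real.exp (-B) / 2 * Real.exp (1 / 2 * x)) atTop atBot := by
    refine tendsto_atBot_mono' _ ?_ tendsto_neg_atTop_atBot
    filter_upwards [eventually_mul_pow_le_exp (4 * Real.exp B) 1 (b := 1 / 2) (by norm_num)]
      with x hx
    have h := mul_le_mul_of_nonneg_left hx (by positivity : 0 ≤ Real.exp (-B) / 2)
    have hB : Real.exp (-B) * Real.exp B = 1 := by
      rw [← Real.exp_add, neg_add_cancel, Real.exp_zero]
    have : Real.exp (-B) / 2 * (4 * Real.exp B * x ^ 1) = 2 * x := by linear_combination 2 * x * hB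
    linarith
  refine ((Real.tendsto_exp_atBot.comp (Real.tendsto_exp_atTop.atTop_mul_atBot₀ hfactor)).comp
    tendsto_log_natCast).congr' ?_
  filter_upwards [eventually_gt_atTop 0] with n hn
  have hn0 : (0 : ℝ) < n := Nat.cast_pos.2 hn
  have hpow : (n : ℝ) ^ n = Real.exp (Real.exp (Real.log n) * Real.log n) := by
    rw [Real.exp_log hn0, Real.exp_nat_mul, Real.exp_log hn0]
  have hR : 1 / (2 * Real.exp (B - 3 / 2 * Real.log n)) =
      Real.exp (Real.log n) * (Real.exp (-B) / 2 * Real.exp (1 / 2 * Real.log n)) := by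
    have hsplit : 3 / 2 * Real.log n - B = Real.log n + (-B + 1 / 2 * Real.log n) := by ring
    rw [one_div, mul_inv, ← Real.exp_neg, neg_sub, hsplit, Real.exp_add, Real.exp_add (-B)]
    ring
  simp only [Function.comp_apply]
  rw [hpow, hR, ← Real.exp_add, mul_sub, sub_eq_add_neg]

variable {k : ℕ} {η : ℝ} {a : Fin k → ℝ}

/-- The type, rounded down, of independent sets slightly below the threshold `a log n`; the factor
`1 - η` is what makes them appear in every large set of vertices. -/
noncomputable def typeSize (η : ℝ) (a : Fin k → ℝ) (n : ℕ) (i : Fin k) : ℕ :=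
  ⌊(1 - η) * Real.log n * a i⌋₊

/-- The number of candidates for each vertex of an independent set that is to be extracted. The
power of the logarithm is large enough for the candidates to fit into a set of `n / log n ^ 2`
vertices. -/
noncomputable def cellSize (n : ℕ) : ℕ := ⌊(n : ℝ) / Real.log n ^ 4⌋₊

theorem eventually_le_cellSize {b : ℝ} (hb : 0 < b) :
    ∀ᶠ n : ℕ in atTop, Real.exp ((1 - b) * Real.log n) ≤ cellSize n := by
  filter_upwards [tendsto_log_natCast.eventually (eventually_mul_pow_le_exp 2 4 hb),
    tendsto_log_natCast.eventually (eventually_mul_pow_le_exp 2 4 one_pos), eventually_ge_atTop 2]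
    with n hpow hpow1 hn
  have hlog : 0 < Real.log n := Real.log_pos (by exact_mod_cast hn)
  have hexp : Real.exp (1 * Real.log n) = n := by
    rw [one_mul, Real.exp_log (by positivity)]
  have htwo : 2 ≤ (n : ℝ) / Real.log n ^ 4 :=
    (le_div_iff₀ (by positivity)).2 (hpow1.trans_eq hexp)
  have hdouble : 2 * Real.exp ((1 - b) * Real.log n) ≤ n / Real.log n ^ 4 := by
    rw [le_div_iff₀ (by positivity)]
    calc _ = Real.exp ((1 - b) * Real.log n) * (2 * Real.log n ^ 4) := by ring
      _ ≤ Real.exp ((1 - b) * Real.log n) * Real.exp (b * Real.log n) := by gcongr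
      _ = n := by rw [← Real.exp_add, ← add_mul, sub_add_cancel, hexp]
  have hfloor := Nat.sub_one_lt_floor ((n : ℝ) / Real.log n ^ 4)
  rw [cellSize]
  linarith

theorem typeSize_le (hη : η ≤ 1) (ha : ∀ i, 0 ≤ a i) (n : ℕ) (i : Fin k) :
    (typeSize η a n i : ℝ) ≤ (1 - η) * Real.log n * a i :=
  Nat.floor_le (mul_nonneg (mul_nonneg (sub_nonneg.2 hη) (Real.log_natCast_nonneg n)) (ha i))

theorem typeSize_le_log_mul (hη0 : 0 ≤ η) (hη : η ≤ 1) (ha : ∀ i, 0 ≤ a i) (n : ℕ) (i : Fin k) :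
    (typeSize η a n i : ℝ) ≤ Real.log n * a i := by
  refine (typeSize_le hη ha n i).trans ?_
  rw [mul_assoc]
  exact mul_le_of_le_one_left (mul_nonneg (Real.log_natCast_nonneg n) (ha i)) (by linarith)

theorem typeSize_mul_cellSize_le (hη0 : 0 ≤ η) (hη : η ≤ 1) (ha : ∀ i, 0 ≤ a i) {n : ℕ}
    (hn : 2 ≤ n) (i : Fin k) :
    (typeSize η a n i * cellSize n : ℝ) ≤ a i * (n / Real.log n ^ 3) := by
  have hlog : 0 < Real.log n := Real.log_pos (by exact_mod_cast hn)
  have hcell : (cellSize n : ℝ) ≤ n / Real.log n ^ 4 := Nat.floor_le (by positivity)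
  have hai := ha i
  calc (typeSize η a n i * cellSize n : ℝ)
      ≤ Real.log n * a i * (n / Real.log n ^ 4) :=
        mul_le_mul (typeSize_le_log_mul hη0 hη ha n i) hcell (Nat.cast_nonneg _) (by positivity)
    _ = _ := by field_simp

theorem eventually_sum_typeSize_le (hη : 0 < η) (hη1 : η ≤ 1) (ha : ∀ i, 0 ≤ a i) :
    ∀ᶠ n : ℕ in atTop, ((∑ i, typeSize η a n i : ℕ) : ℝ) ≤ Real.exp (η * Real.log n / 4) := by
  filter_upwards [tendsto_log_natCast.eventually
    (eventually_mul_pow_le_exp (∑ i, a i) 1 (b := η / 4) (by positivity))] with n hn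
  calc ((∑ i, typeSize η a n i : ℕ) : ℝ) = ∑ i, (typeSize η a n i : ℝ) := Nat.cast_sum _ _
    _ ≤ ∑ i, Real.log n * a i := Finset.sum_le_sum fun i _ => typeSize_le_log_mul hη.le hη1 ha n i
    _ = (∑ i, a i) * Real.log n ^ 1 := by rw [← Finset.mul_sum, pow_one, mul_comm]
    _ ≤ _ := hn
    _ = _ := by rw [div_mul_eq_mul_div]

theorem eventually_sum_typeSize_mul_cellSize_le (hη0 : 0 ≤ η) (hη : η ≤ 1) (ha : ∀ i, 0 ≤ a i) :
    ∀ᶠ n : ℕ in atTop, (∑ i, typeSize η a n i) * cellSize n ≤ n := by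
  filter_upwards [eventually_ge_atTop 2, tendsto_log_natCast.eventually_ge_atTop 1,
    tendsto_log_natCast.eventually_ge_atTop (∑ i, a i)] with n hn hlog1 hlog
  have hreal : (∑ i, (typeSize η a n i : ℝ)) * cellSize n ≤ n := by
    calc (∑ i, (typeSize η a n i : ℝ)) * cellSize n
        = ∑ i, (typeSize η a n i * cellSize n : ℝ) := Finset.sum_mul _ _ _
      _ ≤ ∑ i, a i * (n / Real.log n ^ 3) :=
          Finset.sum_le_sum fun i _ => typeSize_mul_cellSize_le hη0 hη ha hn i
      _ = (∑ i, a i) * (n / Real.log n ^ 3) := (Finset.sum_mul _ _ _).symm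
      _ ≤ Real.log n * (n / Real.log n ^ 3) := by gcongr
      _ = n / Real.log n ^ 2 := by field_simp
      _ ≤ n := div_le_self n.cast_nonneg (one_le_pow₀ hlog1)
  exact_mod_cast hreal

end Scales

theorem tendsto_law_not_extractable {k : ℕ} {α a : Fin k → ℝ} {P : Matrix (Fin k) (Fin k) ℝ}
    (hα : ∀ i, 0 ≤ α i) (hα1 : ∑ i, α i = 1) (hP : P.IsSymm)
    (hP01 : ∀ i j, P i j ∈ Set.Ico (0 : ℝ) 1) (ha : a ∈ admissible P) {η : ℝ} (hη : 0 < η)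
    (hη1 : η ≤ 1 / 2) :
    Tendsto (fun n : ℕ => (law α P hP n).real
      {G | ¬Extractable Sigma.fst (typeSize η a n) (cellSize n) G}) atTop (𝓝 0) := by
  have hη' : η ≤ 1 := by linarith
  refine squeeze_zero' (.of_forall fun n => measureReal_nonneg) ?_
    (tendsto_pow_self_mul_exp_neg (logBound P / 2 * (6 / η) ^ 2 + 1))
  filter_upwards [eventually_le_cellSize (b := η / 8) (by positivity),
    eventually_sum_typeSize_le hη hη' ha.1,
    eventually_sum_typeSize_mul_cellSize_le hη.le hη' ha.1, eventually_ge_atTop 2]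
    with n hcell hsum hsize hn
  have hlog : 0 < Real.log n := Real.log_pos (by exact_mod_cast hn)
  rw [law_eq_blockGraph]
  refine (blockGraph_real_not_extractable_le_of_mem_admissible hP hP01 ha hη hη1 hlog
    (typeSize_le hη' ha.1 n) hsum hcell).trans ?_
  rw [card_vertex hα hα1]
  gcongr
  exact_mod_cast (by omega : 1 ≤ n)

section Coloring

variable {V : Type*} {G : SimpleGraph V}

theorem colorable_induce_union {s t : Set V} {p q : ℕ} (hs : (G.induce s).Colorable p)
    (ht : (G.induce t).Colorable q) : (G.induce (s ∪ t)).Colorable (p + q) := by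
  classical
  obtain ⟨C⟩ := hs
  obtain ⟨D⟩ := ht
  let E : (G.induce (s ∪ t)).Coloring (Fin p ⊕ Fin q) := SimpleGraph.Coloring.mk
    (fun v => if h : (v : V) ∈ s then .inl (C ⟨v, h⟩) else .inr (D ⟨v, v.2.resolve_left h⟩)) <| by
      intro u v huv
      by_cases hu : (u : V) ∈ s <;> by_cases hv : (v : V) ∈ s
      · simpa only [hu, hv, dite_true, ne_eq, Sum.inl.injEq] using C.valid (v := ⟨u, hu⟩)
          (w := ⟨v, hv⟩) huv
      · simp [hu, hv]
      · simp [hu, hv]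
      · simpa only [hu, hv, dite_false, ne_eq, Sum.inr.injEq] using
          D.valid (v := ⟨u, u.2.resolve_left hu⟩) (w := ⟨v, v.2.resolve_left hv⟩) huv
  simpa using E.colorable

theorem colorable_induce_mono {s t : Set V} (h : s ⊆ t) {q : ℕ} (ht : (G.induce t).Colorable q) :
    (G.induce s).Colorable q :=
  ht.of_hom (G.induceHomOfLE h).toHom

theorem colorable_induce_of_isIndepSet {s : Set V} (hs : G.IsIndepSet s) :
    (G.induce s).Colorable 1 :=
  SimpleGraph.colorable_one_iff.2 (SimpleGraph.eq_bot_iff_forall_not_adj.2 fun u v huv =>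
    hs u.2 v.2 (SimpleGraph.Adj.ne huv) huv)

end Coloring

section Greedy

variable {ι : Type*} [DecidableEq ι]

theorem blockCount_mono {V : Type*} {β : V → ι} {S U : Finset V} (h : S ⊆ U) (i : ι) :
    blockCount β S i ≤ blockCount β U i :=
  Finset.card_le_card (Finset.filter_subset_filter _ h)

theorem blockCount_sdiff_add {V : Type*} [DecidableEq V] {β : V → ι} {S U : Finset V} (h : S ⊆ U)
    (i : ι) : blockCount β (U \ S) i + blockCount β S i = blockCount β U i := by
  unfold blockCount
  rw [← Finset.card_sdiff_add_card_eq_card (Finset.filter_subset_filter _ h)]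
  congr 2
  ext v
  simp only [Finset.mem_filter, Finset.mem_sdiff]
  tauto

variable {κ : Type*} {s : κ → ι → ℕ} {r m : ℕ}

/- Independent sets of the types `s l` are removed one after the other, each restricted to the parts
that still have at least `m` vertices. -/
theorem exists_colorable_induce_sdiff [Finite ι] {V : Type*} {β : V → ι} {G : SimpleGraph V}
    (T : Finset κ) (hG : ∀ l ∈ T, ∀ J : Finset ι, Extractable β (Set.indicator J (s l)) r G)
    (hm : ∀ l ∈ T, ∀ i, s l i * r ≤ m) (U : Finset V) :
    ∃ W ⊆ U, (G.induce (U \ W : Set V)).Colorable T.card ∧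
      ∀ i, blockCount β W i < m ∨ blockCount β W i + ∑ l ∈ T, s l i ≤ blockCount β U i := by
  classical
  have := Fintype.ofFinite ι
  induction T using Finset.induction_on generalizing U with
  | empty =>
    refine ⟨U, subset_rfl, ?_, fun i => .inr (by simp)⟩
    rw [Set.sdiff_self]
    exact .of_isEmpty 0
  | insert l T hl ih =>
    let J := Finset.univ.filter fun i => m ≤ blockCount β U i
    obtain ⟨S, hSU, hS, hcount⟩ := hG l (Finset.mem_insert_self l T) J U fun i => by
      by_cases hi : i ∈ J
      · rw [Set.indicator_of_mem (Finset.mem_coe.2 hi)]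
        exact (hm l (Finset.mem_insert_self l T) i).trans (Finset.mem_filter.1 hi).2
      · rw [Set.indicator_of_notMem (by simpa using hi), zero_mul]
        exact Nat.zero_le _
    obtain ⟨W, hWU, hcol, hsize⟩ := ih (fun l' hl' => hG l' (Finset.mem_insert_of_mem hl'))
      (fun l' hl' => hm l' (Finset.mem_insert_of_mem hl')) (U \ S)
    refine ⟨W, hWU.trans Finset.sdiff_subset, ?_, fun i => ?_⟩
    · rw [Finset.card_insert_of_notMem hl, add_comm]
      refine colorable_induce_mono (fun v hv => ?_)
        (colorable_induce_union (colorable_induce_of_isIndepSet hS) hcol)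
      by_cases hvS : v ∈ S
      · exact .inl hvS
      · exact .inr ⟨Finset.mem_coe.2 (Finset.mem_sdiff.2 ⟨hv.1, hvS⟩), hv.2⟩
    · rcases lt_or_ge (blockCount β U i) m with hlt | hge
      · exact .inl ((blockCount_mono (hWU.trans Finset.sdiff_subset) i).trans_lt hlt)
      · refine (hsize i).imp_right fun h => ?_
        have hSi : blockCount β S i = s l i := by
          rw [hcount, Set.indicator_of_mem (by simpa [J] using hge)]
        have hsdiff := blockCount_sdiff_add (β := β) hSU i
        rw [Finset.sum_insert hl]
        omega

theorem chi_le_of_extractable [Fintype ι] {V : Type} [Fintype V] {β : V → ι} {G : SimpleGraph V}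
    (T : Finset κ) (hG : ∀ l ∈ T, ∀ J : Finset ι, Extractable β (Set.indicator J (s l)) r G)
    (hm : ∀ l ∈ T, ∀ i, s l i * r ≤ m)
    (hcover : ∀ i, blockCount β Finset.univ i ≤ ∑ l ∈ T, s l i) :
    chi G ≤ T.card + Fintype.card ι * m := by
  obtain ⟨W, -, hcol, hsize⟩ := exists_colorable_induce_sdiff T hG hm Finset.univ
  have hW : W.card ≤ Fintype.card ι * m := by
    have hcard : W.card = ∑ i, blockCount β W i := by exact_mod_cast (sum_blockCount β W).symm
    rw [hcard, ← smul_eq_mul]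
    refine Finset.sum_le_card_nsmul _ _ _ fun i _ => ?_
    have hi := hsize i
    have hci := hcover i
    omega
  have hunion := colorable_induce_union hcol (G.induce (W : Set V)).colorable_of_fintype
  have hcolG : G.Colorable (T.card + W.card) := by
    rw [Finset.coe_univ, Set.sdiff_union_self, Set.univ_union] at hunion
    simpa using hunion.of_hom G.induceUnivIso.symm.toHom
  have hchi : G.chromaticNumber.toNat ≤ T.card + W.card :=
    ENat.toNat_le_toNat hcolG.chromaticNumber_le (ENat.natCast_ne_top _)
  unfold chi
  exact_mod_cast hchi.trans (Nat.add_le_add_left hW _)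

end Greedy

section Rounding

variable {J : Type*} [Fintype J] {w b : J → ℝ} {x : ℝ}

theorem sum_natCeil_mul_le (hw : ∀ l, 0 ≤ w l) (hw1 : ∑ l, w l = 1) (hx : 0 ≤ x) :
    ∑ l, (⌈w l * x⌉₊ : ℝ) ≤ x + Fintype.card J := by
  calc ∑ l, (⌈w l * x⌉₊ : ℝ) ≤ ∑ l, (w l * x + 1) :=
        Finset.sum_le_sum fun l _ => (Nat.ceil_lt_add_one (mul_nonneg (hw l) hx)).le
    _ = x + Fintype.card J := by
        rw [Finset.sum_add_distrib, ← Finset.sum_mul, hw1]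
        simp

theorem le_sum_natCeil_mul_natFloor (hw : ∀ l, 0 ≤ w l) (hw1 : ∑ l, w l = 1) (hx : 0 ≤ x)
    (hb : ∀ l, 0 ≤ b l) :
    x * ∑ l, w l * b l - (x + Fintype.card J) ≤ ∑ l, (⌈w l * x⌉₊ * ⌊b l⌋₊ : ℝ) := by
  have hceil : x * ∑ l, w l * b l ≤ ∑ l, ⌈w l * x⌉₊ * b l := by
    rw [Finset.mul_sum]
    refine Finset.sum_le_sum fun l _ => ?_
    rw [← mul_assoc, mul_comm x]
    exact mul_le_mul_of_nonneg_right (Nat.le_ceil _) (hb l)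
  have hfloor : ∑ l, (⌈w l * x⌉₊ : ℝ) * (b l - 1) ≤ ∑ l, (⌈w l * x⌉₊ * ⌊b l⌋₊ : ℝ) :=
    Finset.sum_le_sum fun l _ =>
      mul_le_mul_of_nonneg_left (Nat.sub_one_lt_floor _).le (Nat.cast_nonneg _)
  simp only [mul_sub, mul_one, Finset.sum_sub_distrib] at hfloor
  linarith [sum_natCeil_mul_le hw hw1 hx]

theorem eventually_mul_log_add_mul_div_log_le (A B : ℝ) {δ : ℝ} (hδ : 0 < δ) :
    ∀ᶠ n : ℕ in atTop, A * Real.log n + B * (n / Real.log n) ≤ δ * n := by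
  have hnat := tendsto_natCast_atTop_atTop (R := ℝ)
  have hlog : (fun n : ℕ => Real.log n) =o[atTop] fun n : ℕ => (n : ℝ) :=
    Real.isLittleO_log_id_atTop.comp_tendsto hnat
  have hdiv : (fun n : ℕ => (n : ℝ) / Real.log n) =o[atTop] fun n : ℕ => (n : ℝ) := by
    have h := (Asymptotics.isBigO_refl (fun n : ℕ => (n : ℝ)) atTop).mul_isLittleO
      ((Asymptotics.isLittleO_one_iff ℝ).2 (tendsto_inv_atTop_zero.comp tendsto_log_natCast))
    simpa [div_eq_mul_inv, Function.comp_def] using h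
  filter_upwards [((hlog.const_mul_left A).add (hdiv.const_mul_left B)).bound hδ] with n hn
  rw [Real.norm_of_nonneg (Nat.cast_nonneg n)] at hn
  exact (le_abs_self _).trans hn

end Rounding

section UpperBound

variable {k : ℕ} {α : Fin k → ℝ} {P : Matrix (Fin k) (Fin k) ℝ}

theorem indicator_mem_admissible (hPd : ∀ i, 0 ≤ P i i) (hP1 : ∀ i, P i i < 1) {a : Fin k → ℝ}
    (ha : a ∈ admissible P) (I : Finset (Fin k)) : Set.indicator I a ∈ admissible P :=
  mem_admissible_of_le hPd hP1 ha (Set.indicator_nonneg fun i _ => ha.1 i)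
    (Set.indicator_le_self' fun i _ => ha.1 i)

theorem typeSize_indicator (η : ℝ) (a : Fin k → ℝ) (n : ℕ) (I : Finset (Fin k)) :
    typeSize η (Set.indicator I a) n = Set.indicator I (typeSize η a n) := by
  funext i
  by_cases hi : i ∈ (I : Set (Fin k)) <;> simp [typeSize, hi]

theorem typeSize_mul_cellSize_le_floor {η : ℝ} (hη0 : 0 ≤ η) (hη : η ≤ 1) {a : Fin k → ℝ}
    (ha : ∀ i, 0 ≤ a i) {n : ℕ} (hn : 2 ≤ n) {i : Fin k} (hai : a i ≤ Real.log n) :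
    typeSize η a n i * cellSize n ≤ ⌊n / Real.log n ^ 2⌋₊ := by
  have hlog : 0 < Real.log n := Real.log_pos (by exact_mod_cast hn)
  refine Nat.le_floor ?_
  push_cast
  calc (typeSize η a n i * cellSize n : ℝ) ≤ a i * (n / Real.log n ^ 3) :=
        typeSize_mul_cellSize_le hη0 hη ha hn i
    _ ≤ Real.log n * (n / Real.log n ^ 3) := by gcongr
    _ = n / Real.log n ^ 2 := by field_simp

theorem chi_le_of_convexCombination {J V : Type} [Fintype J] [Fintype V] {τ : V → Fin k}
    {G : SimpleGraph V} {a : J → Fin k → ℝ} (ha : ∀ l i, 0 ≤ a l i) {w : J → ℝ}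
    (hw : ∀ l, 0 ≤ w l) (hw1 : ∑ l, w l = 1) {η x : ℝ} (hη0 : 0 ≤ η) (hη : η ≤ 1) (hx : 0 ≤ x)
    {n : ℕ} (hn : 2 ≤ n) (hlog : ∀ l i, a l i ≤ Real.log n)
    (hG : ∀ l (I : Finset (Fin k)),
      Extractable τ (typeSize η (Set.indicator I (a l)) n) (cellSize n) G)
    (hcover : ∀ i, (blockCount τ Finset.univ i : ℝ) ≤
      (1 - η) * Real.log n * x * (∑ l, w l • a l) i - (x + Fintype.card J)) :
    chi G ≤ x + Fintype.card J + k * (n / Real.log n ^ 2) := by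
  have hchi := chi_le_of_extractable (κ := (l : J) × Fin ⌈w l * x⌉₊) (G := G) Finset.univ
    (s := fun l => typeSize η (a l.1) n) (fun l _ I => typeSize_indicator η (a l.1) n I ▸ hG l.1 I)
    (fun l _ i => typeSize_mul_cellSize_le_floor hη0 hη (ha l.1) hn (hlog l.1 i)) fun i => by
      have hround := le_sum_natCeil_mul_natFloor (b := fun l => (1 - η) * Real.log n * a l i) hw
        hw1 hx fun l =>
          mul_nonneg (mul_nonneg (sub_nonneg.2 hη) (Real.log_natCast_nonneg n)) (ha l i)
      have hcov := hcover i
      have hmean : x * ∑ l, w l * ((1 - η) * Real.log n * a l i) =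
          (1 - η) * Real.log n * x * (∑ l, w l • a l) i := by
        simp only [Finset.sum_apply, Pi.smul_apply, smul_eq_mul, Finset.mul_sum]
        exact Finset.sum_congr rfl fun l _ => by ring
      rw [hmean] at hround
      simp only [Fintype.sum_sigma, Finset.sum_const, Finset.card_univ, Fintype.card_fin,
        smul_eq_mul]
      exact_mod_cast hcov.trans hround
  have hcard := sum_natCeil_mul_le hw hw1 hx
  have hfloor : (⌊(n : ℝ) / Real.log n ^ 2⌋₊ : ℝ) ≤ n / Real.log n ^ 2 :=
    Nat.floor_le (by positivity)
  simp only [Finset.card_univ, Fintype.card_sigma, Fintype.card_fin, Nat.cast_sum] at hchi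
  exact hchi.trans (add_le_add hcard (mul_le_mul_of_nonneg_left hfloor k.cast_nonneg))

theorem tendsto_law_exists_not_extractable {J : Type*} [Finite J] (hα : ∀ i, 0 ≤ α i)
    (hα1 : ∑ i, α i = 1) (hP : P.IsSymm) (hP01 : ∀ i j, P i j ∈ Set.Ico (0 : ℝ) 1)
    {a : J → Fin k → ℝ} (ha : ∀ l, a l ∈ admissible P) {η : ℝ} (hη : 0 < η) (hη1 : η ≤ 1 / 2) :
    Tendsto (fun n : ℕ => (law α P hP n).real
      {G | ∃ l, ¬Extractable Sigma.fst (typeSize η (a l) n) (cellSize n) G}) atTop (𝓝 0) := by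
  have := Fintype.ofFinite J
  have hlim := tendsto_finsetSum Finset.univ fun l (_ : l ∈ Finset.univ) =>
    tendsto_law_not_extractable hα hα1 hP hP01 (ha l) hη hη1
  rw [Finset.sum_const_zero] at hlim
  refine squeeze_zero (fun n => measureReal_nonneg) (fun n => ?_) hlim
  rw [Set.ofPred_exists]
  exact measureReal_iUnion_fintype_le _

theorem eventually_add_mul_div_log_sq_le (A B : ℝ) {c δ : ℝ} (hc : 0 < c) (hδ : 0 < δ) :
    ∀ᶠ n : ℕ in atTop, A + B * (n / Real.log n ^ 2) ≤ δ * (n / (c * Real.log n)) := by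
  filter_upwards [eventually_mul_log_add_mul_div_log_le A B (div_pos hδ hc),
    tendsto_log_natCast.eventually_gt_atTop 0] with n hn hlog
  calc A + B * (n / Real.log n ^ 2)
      = (A * Real.log n + B * (n / Real.log n)) / Real.log n := by field_simp
    _ ≤ δ / c * n / Real.log n := by gcongr
    _ = δ * (n / (c * Real.log n)) := by field_simp

theorem eventually_blockSize_le (hα : ∀ i, 0 < α i) (hα1 : ∑ i, α i = 1) {η : ℝ} (hη : 0 < η)
    (A B : ℝ) :
    ∀ᶠ n : ℕ in atTop, ∀ i, (blockSize α n i : ℝ) ≤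
      (1 + η) * (α i * n) - (B * (n / Real.log n) + A) := by
  refine eventually_all.2 fun i => ?_
  filter_upwards [eventually_mul_log_add_mul_div_log_le (k + |A|) B (mul_pos hη (hα i)),
    tendsto_log_natCast.eventually_ge_atTop 1] with n hn hlog
  have hA : (k + |A| : ℝ) ≤ (k + |A|) * Real.log n := le_mul_of_one_le_right (by positivity) hlog
  linarith [blockSize_le (fun j => (hα j).le) hα1 n i, le_abs_self A]

theorem eventually_chi_le_of_extractable {J : Type} [Fintype J] (hα : ∀ i, 0 < α i)
    (hα1 : ∑ i, α i = 1) {a : J → Fin k → ℝ} (ha : ∀ l i, 0 ≤ a l i) {w : J → ℝ}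
    (hw : ∀ l, 0 ≤ w l) (hw1 : ∑ l, w l = 1) {c : ℝ} (hc : 0 < c) (hmean : ∑ l, w l • a l = c • α)
    {η ε : ℝ} (hη : 0 < η) (hη1 : η ≤ 1) (hε : 0 < ε) (hηε : 1 + η ≤ (1 - η) * (1 + ε / 2)) :
    ∀ᶠ n : ℕ in atTop, ∀ G : SimpleGraph (Vertex α n),
      (∀ l (I : Finset (Fin k)),
        Extractable Sigma.fst (typeSize η (Set.indicator I (a l)) n) (cellSize n) G) →
      chi G ≤ (1 + ε) * (n / (c * Real.log n)) := by
  have hlogLarge : ∀ᶠ n : ℕ in atTop, ∀ l i, a l i ≤ Real.log n :=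
    eventually_all.2 fun l => eventually_all.2 fun i => tendsto_log_natCast.eventually_ge_atTop _
  filter_upwards [hlogLarge, eventually_ge_atTop 2,
    eventually_blockSize_le hα hα1 hη (Fintype.card J) ((1 + ε / 2) / c),
    eventually_add_mul_div_log_sq_le (Fintype.card J) k hc (half_pos hε)] with n ha_le hn hsize hrem
    G hG
  have hlog : 0 < Real.log n := Real.log_pos (by exact_mod_cast hn)
  set x : ℝ := (1 + ε / 2) * (n / (c * Real.log n)) with hx
  have hx0 : 0 ≤ x := by positivity
  have hcover : ∀ i, (blockCount Sigma.fst (Finset.univ : Finset (Vertex α n)) i : ℝ) ≤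
      (1 - η) * Real.log n * x * (∑ l, w l • a l) i - (x + Fintype.card J) := fun i => by
    have hxn : (1 - η) * Real.log n * x * (c * α i) = (1 - η) * (1 + ε / 2) * (α i * n) := by
      rw [hx]
      field_simp
    have hx' : x = (1 + ε / 2) / c * (n / Real.log n) := by
      rw [hx]
      field_simp
    have hmul := mul_le_mul_of_nonneg_right hηε (mul_nonneg (hα i).le n.cast_nonneg)
    rw [blockCount_sigma_univ, hmean, Pi.smul_apply, smul_eq_mul, hxn]
    linarith [hsize i]
  have hchi := chi_le_of_convexCombination ha hw hw1 hη.le hη1 hx0 hn ha_le hG hcover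
  linarith

theorem tendsto_law_lt_chi (hα : ∀ i, 0 < α i) (hα1 : oneNorm α = 1) (hP : P.IsSymm)
    (hP01 : ∀ i j, P i j ∈ Set.Ico (0 : ℝ) 1) (hPd : ∀ i, 0 < P i i) {ε : ℝ} (hε : 0 < ε) :
    Tendsto (fun n : ℕ => (law α P hP n).real
      {G | (1 + ε) * (n / (cStar α P * Real.log n)) < chi G}) atTop (𝓝 0) := by
  have hα0 : ∀ i, 0 ≤ α i := fun i => (hα i).le
  have hsum := sum_eq_one_of_oneNorm hα0 hα1
  have hP1 : ∀ i, P i i < 1 := fun i => (hP01 i i).2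
  have hc := cStar_pos hα0 hα1 hPd hP1
  obtain ⟨w, ⟨hw, hw1⟩, a, ha, hmean⟩ :=
    exists_sum_smul_eq_of_mem_convexHull (cStar_smul_mem_convexHull hα1 hPd hP1)
  obtain ⟨η, hη, hη1, hηε⟩ : ∃ η : ℝ, 0 < η ∧ η ≤ 1 / 2 ∧ 1 + η ≤ (1 - η) * (1 + ε / 2) := by
    refine ⟨min (1 / 2) (ε / (4 + ε)), by positivity, min_le_left _ _, ?_⟩
    have h := (le_div_iff₀ (by positivity)).1 (min_le_right (1 / 2) (ε / (4 + ε)))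
    linarith
  have hext := tendsto_law_exists_not_extractable hα0 hsum hP hP01
    (a := fun lI : _ × Finset (Fin k) => Set.indicator lI.2 (a lI.1))
    (fun lI => indicator_mem_admissible (fun i => (hPd i).le) hP1 (ha lI.1) lI.2) hη hη1
  refine squeeze_zero' (.of_forall fun n => measureReal_nonneg) ?_ hext
  filter_upwards [eventually_chi_le_of_extractable hα hsum (fun l => (ha l).1) hw hw1 hc hmean hη
    (hη1.trans (by norm_num)) hε hηε] with n hn
  rw [law_eq_blockGraph]
  refine measureReal_mono (fun G hG => ?_) (measure_ne_top _ _)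
  by_contra hnot
  simp only [Set.mem_ofPred, not_exists, not_not] at hnot
  exact (hn G fun l I => hnot (l, I)).not_gt hG

end UpperBound

end RandomBlockGraph

theorem theorem1_general {k : ℕ} {α : Fin k → ℝ} (hα : ∀ i, 0 < α i)
    (hα1 : RandomBlockGraph.oneNorm α = 1) {P : Matrix (Fin k) (Fin k) ℝ} (hP : P.IsSymm)
    (hP01 : ∀ i j, P i j ∈ Set.Ico (0 : ℝ) 1) (hPd : ∀ i, 0 < P i i) :
    IsGreatest (RandomBlockGraph.rayNorms α P) (RandomBlockGraph.cStar α P) ∧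
    0 < RandomBlockGraph.cStar α P ∧
    ∀ ε : ℝ, 0 < ε →
      Tendsto (fun n : ℕ => RandomBlockGraph.law α P hP n
          {G | |RandomBlockGraph.chi G - n / (RandomBlockGraph.cStar α P * Real.log n)|
            ≤ ε * (n / (RandomBlockGraph.cStar α P * Real.log n))})
        atTop (𝓝 1) := by
  have hP1 : ∀ i, P i i < 1 := fun i => (hP01 i i).2
  refine ⟨RandomBlockGraph.isGreatest_cStar hα1 hPd hP1,
    RandomBlockGraph.cStar_pos (fun i => (hα i).le) hα1 hPd hP1, fun ε hε => ?_⟩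
  have hlim := (RandomBlockGraph.tendsto_law_chi_lt hα hα1 hP hP01 hPd hε).add
    (RandomBlockGraph.tendsto_law_lt_chi hα hα1 hP hP01 hPd hε)
  rw [add_zero] at hlim
  refine RandomBlockGraph.tendsto_law_one hP
    (squeeze_zero (fun n => measureReal_nonneg) (fun n => ?_) hlim)
  refine le_trans ?_ (measureReal_union_le _ _)
  rw [RandomBlockGraph.law_eq_blockGraph]
  refine measureReal_mono (fun G hG => ?_) (measure_ne_top _ _)
  rw [Set.mem_compl_iff, Set.mem_ofPred, abs_le, not_and_or, not_le, not_le] at hG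
  rw [Set.mem_union, Set.mem_ofPred, Set.mem_ofPred]
  exact hG.imp (fun h => by linarith) fun h => by linarith

theorem theorem1 (k : ℕ) (hk : 1 ≤ k) (α : Fin k → ℝ) (hα : ∀ i, α i ∈ Set.Ioc (0 : ℝ) 1)
    (hα1 : RandomBlockGraph.oneNorm α = 1) (P : Matrix (Fin k) (Fin k) ℝ) (hP : P.IsSymm)
    (hP01 : ∀ i j, P i j ∈ Set.Ioo (0 : ℝ) 1) :
    IsGreatest (RandomBlockGraph.rayNorms α P) (RandomBlockGraph.cStar α P) ∧
    0 < RandomBlockGraph.cStar α P ∧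
    ∀ ε : ℝ, 0 < ε →
      Tendsto (fun n : ℕ => RandomBlockGraph.law α P hP n
          {G | |RandomBlockGraph.chi G - n / (RandomBlockGraph.cStar α P * Real.log n)|
            ≤ ε * (n / (RandomBlockGraph.cStar α P * Real.log n))})
        atTop (𝓝 1) :=
  theorem1_general (fun i => (hα i).1) hα1 hP (fun i j => Set.Ioo_subset_Ico_self (hP01 i j))
    fun i => (hP01 i i).1
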